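/- Let $Q$ be a smooth manifold, $\kappa$ a Riemannian metric and $U$ a smooth function on $Q$, $L(v_q)=\tfrac12\kappa(v_q,v_q)-U(q)$ the associated Lagrangian of mechanical type, and $D\subset TQ$ a regular smooth distribution (a smooth vector subbundle). Let $\Theta_Q$ be the canonical one-form on $T^*Q$ and $\Omega_Q=-d\Theta_Q$. Put $\mathcal M=\kappa^\flat(D)\subset T^*Q$, a vector subbundle of $T^*Q$ with inclusion $\iota$ and projection $\tau_{\mathcal M}:\mathcal M\to Q$, $\Theta_{\mathcal M}=\iota^*\Theta_Q$, $\Omega_{\mathcal M}=\iota^*\Omega_Q$, and $$\mathcal C_m=\{v\in T_m\mathcal M : T\tau_{\mathcal M}(v)\in D_{\tau_{\mathcal M}(m)}\},\qquad \mathcal C_m^{\Omega}=\{v\in T_m(T^*Q):\Omega_Q(v,w)=0\ \ \forall w\in\mathcal C_m\}.$$ Let $G$ be a Lie group, with Lie algebra $\mathfrak g$, acting smoothly, freely and properly on $Q$, such that the tangent lift of the action leaves $L$ and $D$ invariant; then $G$ acts on $\mathcal M$ by restriction of the cotangent lifted action. For $\eta\in\mathfrak g$ let $\eta_Q$ and $\eta_{\mathcal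 M}$ be the infinitesimal generators on $Q$ and $\mathcal M$; for a section $\xi$ of $\mathfrak g\times Q\to Q$ put $\xi_Q(q)=(\xi_q)_Q(q)$ and $\xi_{\mathcal M}(m)=(\xi_{\tau_{\mathcal M}(m)})_{\mathcal M}(m)$. Let $V_q\subset T_qQ$ be the tangent space to the $G$-orbit through $q$ and $\mathfrak g_S=\{\xi_q\in\mathfrak g\times Q:\xi_Q(q)\in D_q\cap V_q\}$. Then $\Omega_Q$ is nondegenerate, $T_m(T^*Q)=\mathcal C_m\oplus\mathcal C_m^\Omega$ for every $m\in\mathcal M$, and $\Omega_{\mathcal M}$ is nondegenerate on $\mathcal C$. Hence the following are well defined: the cotangent lift $X^{T^*Q}$ of a vector field $X$ on $Q$, i.e. the vector field on $T^*Q$ with $\mathbf i_{X^{T^*Q}}\Omega_Q=d\tilde X$, where $\tilde X(\alpha)=\alpha(X)$; the projection $\mathcal T_{\mathcal C}(m):T_m(T^*Q)\to\mathcal C_m$ along $\mathcal C_m^\Omega$; the $\mathcal M$-cotangent lift $\xi_Q^{\mathcal M}(m)=\mathcal T_{\mathcal C}\big(\xi_Q^{T^*Q}\big)(m)$; and $\pi_{nh}^\sharp(df)=-X_f$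 for $f\in C^\infty(\mathcal M)$, where $X_f$ is the section of $\mathcal C$ with $\mathbf i_{X_f}\Omega_{\mathcal M}|_{\mathcal C}=df|_{\mathcal C}$. Let $\langle\mathcal J(m),\eta\rangle=\iota(m)(\eta_Q)$ be the canonical momentum map restricted to $\mathcal M$, and let $\langle\mathcal J^{nh},\xi\rangle=\mathbf i_{\xi_{\mathcal M}}\Theta_{\mathcal M}$ for $\xi\in\Gamma(\mathfrak g_S)$. If $\xi\in\Gamma(\mathfrak g_S)$ is given by $\xi=\sum_i f_i\eta_i$ with finitely many $f_i\in C^\infty(Q)$ and $\eta_i\in\mathfrak g$, then (i) $\displaystyle \xi_Q^{\mathcal M}=\xi_{\mathcal M}-\sum_i\langle\mathcal J,\eta_i\rangle\,\pi_{nh}^\sharp(df_i)$, where $f_i$ also denotes the pull-back $f_i\circ\tau_{\mathcal M}$; (ii) $\displaystyle \xi_Q^{\mathcal M}=-\pi_{nh}^\sharp\big(d\langle\mathcal J^{nh},\xi\rangle\big)$. -/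

import Mathlib

open Bundle Set
open scoped Manifold ContDiff Topology

noncomputable section

namespace Nonholonomic

/-! ### Linear algebra of two-forms -/

section LinearAlgebra

variable {V : Type*} [AddCommGroup V] [Module ℝ V] [TopologicalSpace V]

open Classical in
/-- The vector `v ∈ C` determined by `σ(v, w) = β(w)` for all `w ∈ C`.
(The value is `0` if there is no such vector or more than one; this does not happen when `σ` is
nondegenerate on `C` and `V` is finite dimensional.) -/
def hamVector (σ : V →L[ℝ] V →L[ℝ] ℝ) (C : Submodule ℝ V) (β : V →L[ℝ] ℝ) : V :=
  if h : ∃! v : V, v ∈ C ∧ ∀ w ∈ C, σ v w = β w then h.choose else 0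

/-- The orthogonal `C^σ = {v | σ(v, w) = 0 for all w ∈ C}`. -/
def sympOrthogonal (σ : V →L[ℝ] V →L[ℝ] ℝ) (C : Submodule ℝ V) : Submodule ℝ V where
  carrier := {v | ∀ w ∈ C, σ v w = 0}
  add_mem' := by
    intro a b ha hb w hw
    simp [ha w hw, hb w hw]
  zero_mem' := by
    intro w _
    simp
  smul_mem' := by
    intro c a ha w hw
    simp [ha w hw]

end LinearAlgebra

/-! ### The cotangent bundle and its canonical forms -/

section Cotangent

variable (E : Type*) [NormedAddCommGroup E] [NormedSpace ℝ E]
  (Q : Type*) [TopologicalSpace Q] [ChartedSpace E Q] [IsManifold 𝓘(ℝ, E) ∞ Q]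

/-- The cotangent bundle `T*Q`. -/
abbrev CotangentBundle : Type _ :=
  TotalSpace (E →L[ℝ] ℝ) (fun q : Q ↦ TangentSpace 𝓘(ℝ, E) q →L[ℝ] ℝ)

/-- The model of `T*Q` as a manifold. -/
abbrev cotModel : ModelWithCorners ℝ (E × (E →L[ℝ] ℝ)) (ModelProd E (E →L[ℝ] ℝ)) :=
  𝓘(ℝ, E).prod 𝓘(ℝ, E →L[ℝ] ℝ)

variable {E Q}

/-- The canonical projection `τ_Q : T*Q → Q`. -/
def cotProj (α : CotangentBundle E Q) : Q := α.proj

/-- The canonical (Liouville) one-form `Θ_Q` on `T*Q`: `Θ_Q(α)(v) = α(Tτ_Q v)`. -/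
def Theta (α : CotangentBundle E Q) : TangentSpace (cotModel E) α →L[ℝ] ℝ :=
  ContinuousLinearMap.comp (show TangentSpace 𝓘(ℝ, E) (cotProj α) →L[ℝ] ℝ from α.snd)
    (mfderiv (cotModel E) 𝓘(ℝ, E) cotProj α)

end Cotangent

/-- The exterior derivative of a one-form `θ` on a manifold `N` without boundary, at `x`, computed
in the preferred chart `φ` around `x`: if `θ'` is the representative `(φ⁻¹)^* θ`, then
`dθ(v, w) = (Dθ' · v') w' - (Dθ' · w') v'` with `v' = Tφ v` and `w' = Tφ w`. -/
def extDerivOneForm {V : Type*} [NormedAddCommGroup V] [NormedSpace ℝ V]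
    {H : Type*} [TopologicalSpace H] (J : ModelWithCorners ℝ V H)
    {N : Type*} [TopologicalSpace N] [ChartedSpace H N]
    (θ : ∀ x : N, TangentSpace J x →L[ℝ] ℝ) (x : N) :
    TangentSpace J x →L[ℝ] TangentSpace J x →L[ℝ] ℝ :=
  let θ' : V → V →L[ℝ] ℝ := fun y ↦
    (θ ((extChartAt J x).symm y)).comp (mfderiv 𝓘(ℝ, V) J (extChartAt J x).symm y)
  let B : V →L[ℝ] V →L[ℝ] ℝ := fderiv ℝ θ' (extChartAt J x x)
  let A : V →L[ℝ] V := mfderiv J 𝓘(ℝ, V) (extChartAt J x) x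
  show V →L[ℝ] V →L[ℝ] ℝ from (B - B.flip).bilinearComp A A

section Cotangent

variable {E : Type*} [NormedAddCommGroup E] [NormedSpace ℝ E]
  {Q : Type*} [TopologicalSpace Q] [ChartedSpace E Q] [IsManifold 𝓘(ℝ, E) ∞ Q]

/-- The canonical two-form `Ω_Q = -dΘ_Q` on `T*Q`. -/
def Omega (α : CotangentBundle E Q) :
    TangentSpace (cotModel E) α →L[ℝ] TangentSpace (cotModel E) α →L[ℝ] ℝ :=
  -extDerivOneForm (cotModel E) Theta α

/-- `π_Q^♯(β)` for a covector `β` on `T*Q`: minus the vector `v` with `Ω_Q(v, ·) = β`. -/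
def cotSharp (α : CotangentBundle E Q) (β : TangentSpace (cotModel E) α →L[ℝ] ℝ) :
    TangentSpace (cotModel E) α :=
  -hamVector (Omega α) ⊤ β

/-- The linear function `α ↦ α(X)` on `T*Q` defined by a vector field `X` on `Q`. -/
def linearFunction (X : ∀ q : Q, TangentSpace 𝓘(ℝ, E) q) (α : CotangentBundle E Q) : ℝ :=
  α.snd (X α.proj)

/-- The cotangent lift `X^{T*Q} = -π_Q^♯(d(α ↦ α(X)))` of a vector field `X` on `Q`. -/
def cotangentLift (X : ∀ q : Q, TangentSpace 𝓘(ℝ, E) q) (α : CotangentBundle E Q) :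
    TangentSpace (cotModel E) α :=
  -cotSharp α (mfderiv (cotModel E) 𝓘(ℝ, ℝ) (linearFunction X) α)

end Cotangent

/-! ### Symmetries -/

section Action

variable {E : Type*} [NormedAddCommGroup E] [NormedSpace ℝ E]
  {Q : Type*} [TopologicalSpace Q] [ChartedSpace E Q] [IsManifold 𝓘(ℝ, E) ∞ Q]
  {EG : Type*} [NormedAddCommGroup EG] [NormedSpace ℝ EG]
  {G : Type*} [TopologicalSpace G] [ChartedSpace EG G] [Group G] [MulAction G Q]

/-- The tangent map `T_q Φ_g : T_q Q → T_{gq} Q` of the diffeomorphism `Φ_g : q ↦ g • q`. -/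
def tangentAct (g : G) (q : Q) : TangentSpace 𝓘(ℝ, E) q →L[ℝ] TangentSpace 𝓘(ℝ, E) (g • q) :=
  mfderiv 𝓘(ℝ, E) 𝓘(ℝ, E) (fun x : Q ↦ g • x) q

/-- The infinitesimal generator `η_Q(q)`, the derivative of the orbit map `g ↦ g • q` at `1`
in the direction `η ∈ 𝔤 = T_1 G`; linear in `η`. -/
def genQ (q : Q) : GroupLieAlgebra 𝓘(ℝ, EG) G →L[ℝ] TangentSpace 𝓘(ℝ, E) q :=
  show GroupLieAlgebra 𝓘(ℝ, EG) G →L[ℝ] E from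
    mfderiv 𝓘(ℝ, EG) 𝓘(ℝ, E) (fun g : G ↦ g • q) 1

/-- The infinitesimal generator `ξ_Q(q) = (ξ_q)_Q(q)` of a section `ξ` of `𝔤 × Q → Q`. -/
def sectionGenQ (ξ : Q → GroupLieAlgebra 𝓘(ℝ, EG) G) (q : Q) : TangentSpace 𝓘(ℝ, E) q :=
  genQ q (ξ q)

/-- The vertical space `V_q`, the tangent space at `q` to the orbit of `q`. -/
def verticalSpace (EG G : Type*) [NormedAddCommGroup EG] [NormedSpace ℝ EG]
    [TopologicalSpace G] [ChartedSpace EG G] [Group G] [MulAction G Q] (q : Q) :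
    Submodule ℝ (TangentSpace 𝓘(ℝ, E) q) :=
  (genQ (EG := EG) (G := G) q).range

/-- The fibre over `q` of `𝔤_S = {ξ_q | ξ_Q(q) ∈ S_q}`, where `S_q = D_q ∩ V_q`. -/
def gS (D : ∀ q : Q, Submodule ℝ (TangentSpace 𝓘(ℝ, E) q)) (q : Q) :
    Submodule ℝ (GroupLieAlgebra 𝓘(ℝ, EG) G) :=
  (D q ⊓ verticalSpace EG G q).comap (genQ q).toLinearMap

/-- The cotangent lift of the action to `T*Q`: `g • α = α ∘ T(Φ_{g⁻¹})` over `g • q`. -/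
def cotAct (g : G) (α : CotangentBundle E Q) : CotangentBundle E Q :=
  ⟨g • α.proj, ContinuousLinearMap.comp
    (show TangentSpace 𝓘(ℝ, E) (g⁻¹ • g • α.proj) →L[ℝ] ℝ from
      (show E →L[ℝ] ℝ from α.snd)) (tangentAct g⁻¹ (g • α.proj))⟩

/-- The canonical momentum map `J : T*Q → 𝔤*`, `⟨J(α), η⟩ = α(η_Q(q))`. -/
def momentum (α : CotangentBundle E Q) : GroupLieAlgebra 𝓘(ℝ, EG) G →L[ℝ] ℝ :=
  ContinuousLinearMap.comp α.snd (genQ α.proj)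

end Action

/-! ### The constraint manifold -/

section Constraint

variable {E : Type*} [NormedAddCommGroup E] [NormedSpace ℝ E]
  {Q : Type*} [TopologicalSpace Q] [ChartedSpace E Q] [IsManifold 𝓘(ℝ, E) ∞ Q]

/-- A Riemannian metric on `Q`. -/
abbrev RiemMetric (E : Type*) [NormedAddCommGroup E] [NormedSpace ℝ E]
    (Q : Type*) [TopologicalSpace Q] [ChartedSpace E Q] [IsManifold 𝓘(ℝ, E) ∞ Q] : Type _ :=
  ContMDiffRiemannianMetric 𝓘(ℝ, E) ∞ E (fun q : Q ↦ TangentSpace 𝓘(ℝ, E) q)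

/-- The Lagrangian of mechanical type `L(v) = κ(v, v) / 2 - U(q)`. -/
def mechLagrangian (κ : RiemMetric E Q) (U : Q → ℝ) (v : TangentBundle 𝓘(ℝ, E) Q) : ℝ :=
  κ.inner v.proj v.snd v.snd / 2 - U v.proj

/-- The distribution `D` is invariant under the tangent lift of the action of `G`. -/
def DistInvariant (G : Type*) [Group G] [MulAction G Q]
    (D : ∀ q : Q, Submodule ℝ (TangentSpace 𝓘(ℝ, E) q)) : Prop :=
  ∀ (g : G) (q : Q), ∀ v ∈ D q, tangentAct g q v ∈ D (g • q)

/-- The Lagrangian `L : TQ → ℝ` is invariant under the tangent lift of the action of `G`. -/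
def LagrangianInvariant (G : Type*) [Group G] [MulAction G Q]
    (L : TangentBundle 𝓘(ℝ, E) Q → ℝ) : Prop :=
  ∀ (g : G) (q : Q) (v : TangentSpace 𝓘(ℝ, E) q), L ⟨g • q, tangentAct g q v⟩ = L ⟨q, v⟩

/-- The constraint manifold `M = κ^♭(D) ⊆ T*Q`, with its points written as pairs `(q, v)` with
`v ∈ D_q`: such a pair stands for the covector `κ_q(v, ·)`, see `constrIncl`. When `D` is a smooth
vector subbundle of `TQ` with model fibre `F`, this is a vector bundle over `Q`, in particular a
manifold, and `κ^♭` identifies it with a vector subbundle of `T*Q`. -/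
abbrev ConstraintManifold (F : Type*) (D : ∀ q : Q, Submodule ℝ (TangentSpace 𝓘(ℝ, E) q)) :
    Type _ :=
  TotalSpace F (fun q : Q ↦ D q)

/-- The model of the constraint manifold. -/
abbrev constrModel (E : Type*) [NormedAddCommGroup E] [NormedSpace ℝ E]
    (F : Type*) [NormedAddCommGroup F] [NormedSpace ℝ F] :
    ModelWithCorners ℝ (E × F) (ModelProd E F) :=
  𝓘(ℝ, E).prod 𝓘(ℝ, F)

variable {F : Type*} [NormedAddCommGroup F] [NormedSpace ℝ F]
  {D : ∀ q : Q, Submodule ℝ (TangentSpace 𝓘(ℝ, E) q)}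

/-- The inclusion `D → TQ`. -/
def distIncl (m : ConstraintManifold F D) : TangentBundle 𝓘(ℝ, E) Q :=
  ⟨m.proj, m.snd⟩

/-- The inclusion `ι : M → T*Q`, `(q, v) ↦ κ_q(v, ·)`. -/
def constrIncl (κ : RiemMetric E Q) (m : ConstraintManifold F D) : CotangentBundle E Q :=
  ⟨m.proj, κ.inner m.proj m.snd⟩

/-- The canonical projection `τ_M : M → Q`. -/
def constrProj (m : ConstraintManifold F D) : Q := m.proj

theorem range_constrIncl (κ : RiemMetric E Q) :
    range (constrIncl (F := F) (D := D) κ) =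
      {α : CotangentBundle E Q | ∃ v ∈ D α.proj, α.snd = κ.inner α.proj v} := by
  ext ⟨q, a⟩
  constructor
  · rintro ⟨⟨q', v⟩, h⟩
    obtain rfl : q' = q := congrArg TotalSpace.proj h
    refine ⟨v.1, v.2, ?_⟩
    simpa [constrIncl] using h.symm
  · rintro ⟨v, hv, h⟩
    refine ⟨⟨q, ⟨v, hv⟩⟩, ?_⟩
    simpa [constrIncl] using h.symm

theorem constrIncl_injective (κ : RiemMetric E Q) :
    Function.Injective (constrIncl (F := F) (D := D) κ) := by
  rintro ⟨q, v, hv⟩ ⟨q', v', hv'⟩ h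
  obtain rfl : q = q' := congrArg TotalSpace.proj h
  have h2 : κ.inner q v = κ.inner q v' := by
    simpa [constrIncl] using h
  have h3 : v - v' = 0 := by
    by_contra hne
    have h4 := κ.pos q _ hne
    have h5 : κ.inner q (v - v') = 0 := by rw [map_sub, h2, sub_self]
    rw [h5] at h4
    simp at h4
  obtain rfl : v = v' := sub_eq_zero.mp h3
  rfl

variable {EG : Type*} [NormedAddCommGroup EG] [NormedSpace ℝ EG]
  {G : Type*} [TopologicalSpace G] [ChartedSpace EG G] [Group G] [MulAction G Q]

/-- The action of `G` on `M`. In terms of pairs `(q, v)` it is `(g • q, Tg v)`; for an invariant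
Lagrangian it is the restriction of the lifted action on `T*Q`, see `constrIncl_constrAct`. -/
def constrAct (hD : DistInvariant G D) (g : G) (m : ConstraintManifold F D) :
    ConstraintManifold F D :=
  ⟨g • m.proj, ⟨tangentAct g m.proj m.snd, hD g m.proj m.snd m.snd.2⟩⟩

theorem metric_invariant {κ : RiemMetric E Q} {U : Q → ℝ}
    (hL : LagrangianInvariant G (mechLagrangian κ U)) (g : G) (q : Q)
    (v w : TangentSpace 𝓘(ℝ, E) q) :
    κ.inner (g • q) (tangentAct g q v) (tangentAct g q w) = κ.inner q v w := by
  have h0 := hL g q 0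
  have h1 := hL g q v
  have h2 := hL g q w
  have h3 := hL g q (v + w)
  have s1 := κ.symm q w v
  have s2 := κ.symm (g • q) (tangentAct g q w) (tangentAct g q v)
  simp only [mechLagrangian, map_add, map_zero, add_apply] at h0 h1 h2 h3
  linarith

theorem constrIncl_constrAct [ContMDiffSMul 𝓘(ℝ, EG) 𝓘(ℝ, E) ∞ G Q]
    {κ : RiemMetric E Q} {U : Q → ℝ}
    (hL : LagrangianInvariant G (mechLagrangian κ U)) (hD : DistInvariant G D) (g : G)
    (m : ConstraintManifold F D) :
    constrIncl κ (constrAct hD g m) = cotAct g (constrIncl κ m) := by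
  obtain ⟨q, v, hv⟩ := m
  have hsm : ∀ h : G, MDifferentiable 𝓘(ℝ, E) 𝓘(ℝ, E) (fun x : Q ↦ h • x) := fun h ↦
    ((ContMDiffSMul.contMDiff_smul (I := 𝓘(ℝ, EG)) (I' := 𝓘(ℝ, E)) (n := ∞) (G := G)
      (M := Q)).comp (contMDiff_const.prodMk contMDiff_id)).mdifferentiable (by simp)
  have key : ∀ w : E, (show E →L[ℝ] E from tangentAct g q)
      ((show E →L[ℝ] E from tangentAct g⁻¹ (g • q)) w) = w := by
    have hx : ∀ x : Q, x = q → HasMFDerivAt 𝓘(ℝ, E) 𝓘(ℝ, E) (fun x : Q ↦ g • x) x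
        (show E →L[ℝ] E from tangentAct g q) := by
      rintro x rfl
      exact (hsm g x).hasMFDerivAt
    have hc := (hx (g⁻¹ • g • q) (inv_smul_smul g q)).comp (g • q) (hsm g⁻¹ (g • q)).hasMFDerivAt
    have hid : ((fun x : Q ↦ g • x) ∘ fun x : Q ↦ g⁻¹ • x) = id := by
      ext x
      simp
    rw [hid] at hc
    have := hasMFDerivAt_unique hc (hasMFDerivAt_id (g • q))
    intro w
    exact congrArg (fun T : E →L[ℝ] E ↦ T w) this
  have h2 : (κ.inner (g • q) (tangentAct g q v) : E →L[ℝ] ℝ) =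
      (show E →L[ℝ] ℝ from κ.inner q v).comp
        (show E →L[ℝ] E from tangentAct g⁻¹ (g • q)) := by
    ext w
    have h3 := metric_invariant hL g q v ((show E →L[ℝ] E from tangentAct g⁻¹ (g • q)) w)
    have h4 := key w
    refine Eq.trans ?_ h3
    exact congrArg (fun u : E ↦ κ.inner (g • q) (tangentAct g q v) u) h4.symm
  exact congrArg (TotalSpace.mk (g • q)) h2

variable [TopologicalSpace (ConstraintManifold F D)] [FiberBundle F (fun q : Q ↦ D q)]

/-- The differential `T_m ι : T_m M → T_m(T*Q)` of the inclusion. -/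
def inclDeriv (κ : RiemMetric E Q) (m : ConstraintManifold F D) :
    TangentSpace (constrModel E F) m →L[ℝ] TangentSpace (cotModel E) (constrIncl κ m) :=
  mfderiv (constrModel E F) (cotModel E) (constrIncl κ) m

/-- The distribution `C_m = {v ∈ T_m M | Tτ_M v ∈ D}` on `M`. -/
def distC (m : ConstraintManifold F D) : Submodule ℝ (TangentSpace (constrModel E F) m) :=
  (D (constrProj m)).comap (mfderiv (constrModel E F) 𝓘(ℝ, E) constrProj m).toLinearMap

/-- `C_m` as a subspace of `T_m(T*Q)`. -/
def distCImage (κ : RiemMetric E Q) (m : ConstraintManifold F D) :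
    Submodule ℝ (TangentSpace (cotModel E) (constrIncl κ m)) :=
  (distC m).map (inclDeriv κ m).toLinearMap

/-- `Θ_M = ι^* Θ_Q`. -/
def ThetaM (κ : RiemMetric E Q) (m : ConstraintManifold F D) :
    TangentSpace (constrModel E F) m →L[ℝ] ℝ :=
  (Theta (constrIncl κ m)).comp (inclDeriv κ m)

/-- `Ω_M = ι^* Ω_Q`. -/
def OmegaM (κ : RiemMetric E Q) (m : ConstraintManifold F D) :
    TangentSpace (constrModel E F) m →L[ℝ] TangentSpace (constrModel E F) m →L[ℝ] ℝ :=
  let A : E × F →L[ℝ] E × (E →L[ℝ] ℝ) := inclDeriv κ m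
  let B : E × (E →L[ℝ] ℝ) →L[ℝ] E × (E →L[ℝ] ℝ) →L[ℝ] ℝ := Omega (constrIncl κ m)
  show E × F →L[ℝ] E × F →L[ℝ] ℝ from B.bilinearComp A A

/-- `π_nh^♯(β)` for a covector `β` on `M` at `m`. For `β = df` it is `-X_f`, where `X_f ∈ C` is the
nonholonomic Hamiltonian vector, `Ω_M(X_f, ·)|_C = df|_C`; indeed
`dg(π_nh^♯(df)) = π_nh(df, dg) = {f, g}_nh = -X_f(g)`. -/
def nhSharp (κ : RiemMetric E Q) (m : ConstraintManifold F D)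
    (β : TangentSpace (constrModel E F) m →L[ℝ] ℝ) : TangentSpace (constrModel E F) m :=
  -hamVector (OmegaM κ m) (distC m) β

open Classical in
/-- The projection `T_C(m) : T_m(T*Q) → C_m` along `C_m^Ω`: the vector `v ∈ C_m` such that
`Y - v ∈ C_m^Ω`. (The value is `0` if there is no such vector or more than one; this does not
happen when `T_m(T*Q) = C_m ⊕ C_m^Ω`.) -/
def projC (κ : RiemMetric E Q) (m : ConstraintManifold F D)
    (Y : TangentSpace (cotModel E) (constrIncl κ m)) : TangentSpace (constrModel E F) m :=
  if h : ∃! v : TangentSpace (constrModel E F) m, v ∈ distC m ∧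
      Y - inclDeriv κ m v ∈ sympOrthogonal (Omega (constrIncl κ m)) (distCImage κ m)
  then h.choose else 0

/-- The `M`-cotangent lift `ξ_Q^M = T_C(ξ_Q^{T*Q})` of the infinitesimal generator of a section
`ξ` of `𝔤 × Q → Q`. -/
def mCotangentLift (κ : RiemMetric E Q) (ξ : Q → GroupLieAlgebra 𝓘(ℝ, EG) G)
    (m : ConstraintManifold F D) : TangentSpace (constrModel E F) m :=
  projC κ m (cotangentLift (sectionGenQ ξ) (constrIncl κ m))

/-- The infinitesimal generator `η_M(m)` of the action on `M`; linear in `η ∈ 𝔤`. -/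
def genM (hD : DistInvariant G D) (m : ConstraintManifold F D) :
    GroupLieAlgebra 𝓘(ℝ, EG) G →L[ℝ] TangentSpace (constrModel E F) m :=
  show GroupLieAlgebra 𝓘(ℝ, EG) G →L[ℝ] E × F from
    mfderiv 𝓘(ℝ, EG) (constrModel E F) (fun g : G ↦ constrAct hD g m) 1

/-- The infinitesimal generator `ξ_M(m) = (ξ_q)_M(m)` of a section `ξ` of `𝔤 × Q → Q`. -/
def sectionGenM (hD : DistInvariant G D) (ξ : Q → GroupLieAlgebra 𝓘(ℝ, EG) G)
    (m : ConstraintManifold F D) : TangentSpace (constrModel E F) m :=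
  genM hD m (ξ (constrProj m))

/-- The function `⟨J^nh, ξ⟩ = i_{ξ_M} Θ_M` on `M`. -/
def nhMomentum (κ : RiemMetric E Q) (hD : DistInvariant G D)
    (ξ : Q → GroupLieAlgebra 𝓘(ℝ, EG) G) (m : ConstraintManifold F D) : ℝ :=
  ThetaM κ m (sectionGenM hD ξ m)

end Constraint

end Nonholonomic

end

open Bundle Set
open scoped Manifold ContDiff Topology

noncomputable section

namespace Nonholonomic

/-! ### Bundle projections in the preferred charts -/

section BundleProj

variable {E : Type*} [NormedAddCommGroup E] [NormedSpace ℝ E]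
  {Q : Type*} [TopologicalSpace Q] [ChartedSpace E Q]
  {F : Type*} [NormedAddCommGroup F] [NormedSpace ℝ F]
  {Z : Q → Type*} [TopologicalSpace (TotalSpace F Z)] [∀ q, TopologicalSpace (Z q)]
  [FiberBundle F Z]

/-! Everything is tested against `C`. Since `Ω_M` is nondegenerate on `C`, a vector of `C_m` is
determined by its pairings with `C_m`, and `ξ_Q^M` is the one with `Ω_M(ξ_Q^M, w) = d(α ↦ α(ξ_Q))(Tι
w)` for all `w ∈ C_m` (`mCotangentLift_eq`). For (ii), the function `α ↦ α(ξ_Q)` pulled back by `ι`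
is `⟨J^nh, ξ⟩`, because `ξ_M` projects to `ξ_Q` (`nhMomentum_eq`). For (i), this function is `∑ f_i
⟨J, η_i⟩`. By the Leibniz rule its differential is `∑ f_i d⟨J, η_i⟩ + ∑ ⟨J, η_i⟩ df_i`; the first
sum is represented by `ξ_M` since `i_{η_M} Ω_M = d⟨J, η⟩` (`omegaM_genM`), the second by the
`π_nh^♯` terms. The condition `ξ_Q ∈ D` puts `ξ_M` in `C`.

The geometric inputs are computed at one point in the preferred charts there, where tangent spaces
become `E × F` or `E × E*`. In such a chart `Θ_Q = p dq`, so `Ω_Q((a, p), (b, r)) = r(a) - p(b)`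
(`omega_apply`).

Nondegeneracy on `C` (`omegaM_nondegenerate`): for `v ∈ C` over `a ∈ D`, pairing with the vertical
vector of fibre part `a` gives `κ(a, a)`, so `a = 0`. Then `v` is vertical with fibre part `s ∈ D`,
and pairing with a vector over `s` gives `-κ(s, s)`. The splitting of `T_m(T*Q)` follows by linear
algebra.

The identity `i_{η_M} Ω_M = d⟨J, η⟩` comes from the action `φ(g, x)` in charts. Differentiating the
invariance `κ(gv, ga) = κ(v, a)` at `g = 1` gives the fibre part of `η_M` in terms of `D²φ((η, 0),
(0, a))`; differentiating `α(η_Q)` produces `D²φ((0, a), (η, 0))`. These agree by symmetry of second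
derivatives. Beforehand, the orbit map into `M` must be shown differentiable
(`mdifferentiableAt_constrAct`), since only the inclusion of `D` and the action on `Q` are known to
be smooth. -/

theorem proj_extChartAt_symm (p : TotalSpace F Z) {y : E × F}
    (hy : y ∈ (extChartAt (𝓘(ℝ, E).prod 𝓘(ℝ, F)) p).target) :
    ((extChartAt (𝓘(ℝ, E).prod 𝓘(ℝ, F)) p).symm y).proj =
      (extChartAt 𝓘(ℝ, E) p.proj).symm y.1 := by
  rw [FiberBundle.extChartAt_target] at hy
  rw [FiberBundle.extChartAt]
  exact (trivializationAt F Z p.proj).proj_symm_apply' hy.1.2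

/-- In the preferred charts, the derivative of a bundle projection is the first projection. -/
theorem hasMFDerivAt_bundleProj (p : TotalSpace F Z) :
    HasMFDerivAt (𝓘(ℝ, E).prod 𝓘(ℝ, F)) 𝓘(ℝ, E) (TotalSpace.proj : TotalSpace F Z → Q) p
      (ContinuousLinearMap.fst ℝ E F) := by
  refine ⟨(FiberBundle.continuous_proj F Z).continuousAt, ?_⟩
  have h : HasFDerivWithinAt (Prod.fst : E × F → E) (ContinuousLinearMap.fst ℝ E F)
      (range (𝓘(ℝ, E).prod 𝓘(ℝ, F))) (extChartAt (𝓘(ℝ, E).prod 𝓘(ℝ, F)) p p) :=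
    hasFDerivAt_fst.hasFDerivWithinAt
  have heq : ∀ y ∈ (extChartAt (𝓘(ℝ, E).prod 𝓘(ℝ, F)) p).target,
      writtenInExtChartAt (𝓘(ℝ, E).prod 𝓘(ℝ, F)) 𝓘(ℝ, E) p
        (TotalSpace.proj : TotalSpace F Z → Q) y = y.1 := by
    intro y hy
    have h1 := hy
    rw [FiberBundle.extChartAt_target] at h1
    simp only [writtenInExtChartAt, Function.comp_apply]
    rw [proj_extChartAt_symm p hy]
    exact (extChartAt 𝓘(ℝ, E) p.proj).right_inv h1.1.1
  exact h.congr_of_eventuallyEq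
    (Filter.mem_of_superset (extChartAt_target_mem_nhdsWithin p) heq)
    (heq _ (mem_extChartAt_target p))

end BundleProj

/-- The bilinear form `((a, p), (b, r)) ↦ j(p)(b)` on `E × W`. -/
def pairingForm (E : Type*) [NormedAddCommGroup E] [NormedSpace ℝ E]
    {W : Type*} [NormedAddCommGroup W] [NormedSpace ℝ W] (j : W →L[ℝ] E →L[ℝ] ℝ) :
    E × W →L[ℝ] E × W →L[ℝ] ℝ :=
  ((ContinuousLinearMap.compL ℝ (E × W) E ℝ).flip (ContinuousLinearMap.fst ℝ E W)).comp
    (j.comp (ContinuousLinearMap.snd ℝ E W))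

/-- The exterior derivative of a one-form whose representative in the preferred chart is linear. -/
theorem extDerivOneForm_apply_of_eventuallyEq {V : Type*} [NormedAddCommGroup V] [NormedSpace ℝ V]
    {H : Type*} [TopologicalSpace H] {J : ModelWithCorners ℝ V H}
    {N : Type*} [TopologicalSpace N] [ChartedSpace H N] [IsManifold J 1 N]
    {θ : ∀ x : N, TangentSpace J x →L[ℝ] ℝ} {x : N} {K : V →L[ℝ] V →L[ℝ] ℝ}
    (h : ∀ᶠ y in 𝓝 (extChartAt J x x), (θ ((extChartAt J x).symm y)).comp
      (mfderiv 𝓘(ℝ, V) J (extChartAt J x).symm y) = K y) (v w : V) :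
    extDerivOneForm J θ x v w = K v w - K w v := by
  have hder : fderiv ℝ (fun y : V ↦ (show V →L[ℝ] ℝ from (θ ((extChartAt J x).symm y)).comp
      (mfderiv 𝓘(ℝ, V) J (extChartAt J x).symm y))) (extChartAt J x x) = K :=
    HasFDerivAt.fderiv (K.hasFDerivAt.congr_of_eventuallyEq h)
  -- The tangent space at `x` is the model space through the preferred chart at `x`, so that chart
  -- has identity derivative there.
  have hA : mfderiv J 𝓘(ℝ, V) (extChartAt J x) x = ContinuousLinearMap.id ℝ V :=
    mfderiv_extChartAt_self
  have h1 : ∀ u : V, (show V →L[ℝ] V from mfderiv J 𝓘(ℝ, V) (extChartAt J x) x) u = u :=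
    fun u ↦ congrArg (fun T : V →L[ℝ] V ↦ T u) hA
  rw [← hder]
  conv_rhs => rw [← h1 v, ← h1 w]
  rfl

/-! ### Canonical forms in cotangent coordinates -/

section Cotangent

variable {E : Type*} [NormedAddCommGroup E] [NormedSpace ℝ E]
  {Q : Type*} [TopologicalSpace Q] [ChartedSpace E Q] [IsManifold 𝓘(ℝ, E) ∞ Q]

/-- The cotangent bundle read in the preferred chart at `α`. -/
theorem extChartAt_cotangent_apply (α β : CotangentBundle E Q) :
    extChartAt (cotModel E) α β = (extChartAt 𝓘(ℝ, E) α.proj β.proj,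
      ContinuousLinearMap.comp β.snd
        ((trivializationAt E (TangentSpace 𝓘(ℝ, E)) α.proj).symmL ℝ β.proj)) := by
  refine Eq.trans (b := (chartAt (ModelProd E (E →L[ℝ] ℝ)) α β)) rfl ?_
  rw [hom_chart (HB := E) α β]
  congr 1
  ext w
  simp [ContinuousLinearMap.inCoordinates]

theorem mem_extChartAt_cotangent_target {α : CotangentBundle E Q} {y : E × (E →L[ℝ] ℝ)} :
    y ∈ (extChartAt (cotModel E) α).target ↔ y.1 ∈ (extChartAt 𝓘(ℝ, E) α.proj).target := by
  rw [FiberBundle.extChartAt_target]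
  constructor
  · rintro h
    exact h.1.1
  · intro h
    refine ⟨⟨h, ?_⟩, trivial⟩
    have := (extChartAt 𝓘(ℝ, E) α.proj).map_target h
    rw [extChartAt_source] at this
    exact ⟨this, trivial⟩

theorem mfderiv_cotProj (α : CotangentBundle E Q) :
    mfderiv (cotModel E) 𝓘(ℝ, E) cotProj α = ContinuousLinearMap.fst ℝ E (E →L[ℝ] ℝ) :=
  (hasMFDerivAt_bundleProj α).mfderiv

/-- In the preferred chart at `α`, the canonical one-form is `p dq`. -/
theorem theta_comp_mfderiv_symm (α : CotangentBundle E Q) {y : E × (E →L[ℝ] ℝ)}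
    (hy : y ∈ (extChartAt (cotModel E) α).target) :
    (Theta ((extChartAt (cotModel E) α).symm y)).comp
      (mfderiv 𝓘(ℝ, E × (E →L[ℝ] ℝ)) (cotModel E) (extChartAt (cotModel E) α).symm y) =
    y.2.comp (ContinuousLinearMap.fst ℝ E (E →L[ℝ] ℝ)) := by
  have hy1 := mem_extChartAt_cotangent_target.1 hy
  have hsymm : MDifferentiableAt 𝓘(ℝ, E × (E →L[ℝ] ℝ)) (cotModel E)
      (extChartAt (cotModel E) α).symm y := by
    rw [← mdifferentiableWithinAt_univ, ← ModelWithCorners.range_eq_univ (cotModel E)]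
    exact mdifferentiableWithinAt_extChartAt_symm hy
  have hsymm1 : MDifferentiableAt 𝓘(ℝ, E) 𝓘(ℝ, E)
      (extChartAt 𝓘(ℝ, E) α.proj).symm y.1 := by
    rw [← mdifferentiableWithinAt_univ, ← ModelWithCorners.range_eq_univ 𝓘(ℝ, E)]
    exact mdifferentiableWithinAt_extChartAt_symm hy1
  set β := (extChartAt (cotModel E) α).symm y with hβ
  have hinv : extChartAt (cotModel E) α β = y := (extChartAt (cotModel E) α).right_inv hy
  -- The projection after the inverse chart of `T*Q` is the inverse chart of `Q` after `Prod.fst`.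
  -- Both ways of differentiating this map must agree.
  have h1 := (hasMFDerivAt_bundleProj β).comp y hsymm.hasMFDerivAt
  have h2 : HasMFDerivAt 𝓘(ℝ, E × (E →L[ℝ] ℝ)) 𝓘(ℝ, E)
    ((extChartAt 𝓘(ℝ, E) α.proj).symm ∘ Prod.fst) y _ := hsymm1.hasMFDerivAt.comp y
      (hasFDerivAt_fst (𝕜 := ℝ) (E := E) (F := E →L[ℝ] ℝ) (p := y)).hasMFDerivAt
  have h3 := hasMFDerivAt_unique h1 (h2.congr_of_eventuallyEq (by
    filter_upwards [extChartAt_target_mem_nhds' hy] with z hz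
    exact proj_extChartAt_symm α hz))
  have hbase : β.proj = (extChartAt 𝓘(ℝ, E) α.proj).symm y.1 := proj_extChartAt_symm α hy
  have hx : β.proj ∈ (chartAt E α.proj).source := by
    rw [hbase, ← extChartAt_source 𝓘(ℝ, E)]
    exact (extChartAt 𝓘(ℝ, E) α.proj).map_target hy1
  rw [extChartAt_cotangent_apply] at hinv
  have h4 := congrArg Prod.fst hinv
  have h5 := congrArg Prod.snd hinv
  simp only at h4 h5
  -- The fibre coordinate `y.2` is `β` composed with the derivative of the inverse base chart, the
  -- same derivative that occurs in `h3`.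
  rw [TangentBundle.symmL_trivializationAt hx, h4, ModelWithCorners.range_eq_univ,
    mfderivWithin_univ] at h5
  rw [← h5, Theta, mfderiv_cotProj]
  ext w : 1
  exact congrArg (show E →L[ℝ] ℝ from β.snd)
    (congrArg (fun T : E × (E →L[ℝ] ℝ) →L[ℝ] E ↦ T w) h3)

/-- The canonical two-form in the preferred chart. -/
theorem omega_apply (α : CotangentBundle E Q) (v w : E × (E →L[ℝ] ℝ)) :
    Omega α v w = w.2 v.1 - v.2 w.1 := by
  have h := extDerivOneForm_apply_of_eventuallyEq (J := cotModel E) (θ := Theta) (x := α)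
    (K := pairingForm E (ContinuousLinearMap.id ℝ (E →L[ℝ] ℝ))) (by
      filter_upwards [extChartAt_target_mem_nhds (I := cotModel E) α] with y hy
      exact theta_comp_mfderiv_symm α hy) v w
  change -(extDerivOneForm (cotModel E) Theta α v w) = _
  rw [h]
  change -(v.2 w.1 - w.2 v.1) = _
  ring

end Cotangent

/-! ### Representing functionals by a form nondegenerate on a subspace -/

section LinearAlgebra

variable {V : Type*} [AddCommGroup V] [Module ℝ V] [TopologicalSpace V]
  {σ : V →L[ℝ] V →L[ℝ] ℝ} {C : Submodule ℝ V}

theorem hamVector_eq (hσ : ∀ v ∈ C, (∀ w ∈ C, σ v w = 0) → v = 0) {β : V →L[ℝ] ℝ} {v : V}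
    (hv : v ∈ C) (h : ∀ w ∈ C, σ v w = β w) : hamVector σ C β = v := by
  have hex : ∃! v : V, v ∈ C ∧ ∀ w ∈ C, σ v w = β w := by
    refine ⟨v, ⟨hv, h⟩, fun u hu ↦ ?_⟩
    refine sub_eq_zero.1 (hσ _ (C.sub_mem hu.1 hv) fun w hw ↦ ?_)
    rw [map_sub, sub_apply, hu.2 w hw, h w hw, sub_self]
  rw [hamVector, dif_pos hex]
  exact hex.unique hex.choose_spec.1 ⟨hv, h⟩

/-- Nondegeneracy makes `C → C*` injective, hence surjective by equality of dimensions. -/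
theorem exists_mem_forall_apply_eq [FiniteDimensional ℝ C]
    (hσ : ∀ v ∈ C, (∀ w ∈ C, σ v w = 0) → v = 0) (β : V →L[ℝ] ℝ) :
    ∃ v ∈ C, ∀ w ∈ C, σ v w = β w := by
  let T : C →ₗ[ℝ] Module.Dual ℝ C :=
    { toFun := fun v ↦ (σ v).toLinearMap.comp C.subtype
      map_add' := by intro a b; ext w; simp
      map_smul' := by intro c a; ext w; simp }
  have hT : Function.Injective T := by
    rw [← LinearMap.ker_eq_bot, LinearMap.ker_eq_bot']
    intro v hv
    refine Subtype.ext (hσ v v.2 fun w hw ↦ ?_)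
    exact LinearMap.congr_fun hv ⟨w, hw⟩
  have hs : Function.Surjective T :=
    (LinearMap.injective_iff_surjective_of_finrank_eq_finrank
      Subspace.dual_finrank_eq.symm).1 hT
  obtain ⟨v, hv⟩ := hs (β.toLinearMap.comp C.subtype)
  exact ⟨v, v.2, fun w hw ↦ LinearMap.congr_fun hv ⟨w, hw⟩⟩

theorem hamVector_spec [FiniteDimensional ℝ C]
    (hσ : ∀ v ∈ C, (∀ w ∈ C, σ v w = 0) → v = 0) (β : V →L[ℝ] ℝ) :
    hamVector σ C β ∈ C ∧ ∀ w ∈ C, σ (hamVector σ C β) w = β w := by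
  obtain ⟨v, hv, h⟩ := exists_mem_forall_apply_eq hσ β
  rw [hamVector_eq hσ hv h]
  exact ⟨hv, h⟩

/-- Disjointness is nondegeneracy itself. The `C`-component of `Y` is the vector that represents
`σ(Y, ·)` on `C`; only the restriction of `σ` to `C` has to be nondegenerate. -/
theorem isCompl_sympOrthogonal [FiniteDimensional ℝ C]
    (hσ : ∀ v ∈ C, (∀ w ∈ C, σ v w = 0) → v = 0) : IsCompl C (sympOrthogonal σ C) := by
  constructor
  · rw [Submodule.disjoint_def]
    exact fun v hv hv' ↦ hσ v hv hv'
  · rw [codisjoint_iff, eq_top_iff]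
    rintro Y -
    obtain ⟨v, hv, h⟩ := exists_mem_forall_apply_eq hσ (σ Y)
    refine Submodule.mem_sup.2 ⟨v, hv, Y - v, fun w hw ↦ ?_, by simp⟩
    rw [map_sub, sub_apply, h w hw, sub_self]

end LinearAlgebra

/-! ### Vertical velocities in a vector bundle -/

section VectorBundle

variable {E : Type*} [NormedAddCommGroup E] [NormedSpace ℝ E]
  {Q : Type*} [TopologicalSpace Q] [ChartedSpace E Q]
  {F : Type*} [NormedAddCommGroup F] [NormedSpace ℝ F]
  {Z : Q → Type*} [TopologicalSpace (TotalSpace F Z)] [∀ q, TopologicalSpace (Z q)]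
  [∀ q, AddCommGroup (Z q)] [∀ q, Module ℝ (Z q)]
  [FiberBundle F Z] [VectorBundle ℝ F Z]

/-- The velocity of a straight line in a fibre of a vector bundle. -/
theorem hasMFDerivAt_fibreLine (q : Q) (z s : Z q) :
    HasMFDerivAt 𝓘(ℝ, ℝ) (𝓘(ℝ, E).prod 𝓘(ℝ, F))
      (fun t : ℝ ↦ (⟨q, z + t • s⟩ : TotalSpace F Z)) 0
      (ContinuousLinearMap.toSpanSingleton ℝ ((0, (trivializationAt F Z q ⟨q, s⟩).2) : E × F)) := by
  have hq := FiberBundle.mem_baseSet_trivializationAt' (F := F) (E := Z) q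
  have hlin : ∀ t : ℝ, (trivializationAt F Z q ⟨q, z + t • s⟩).2 =
      (trivializationAt F Z q ⟨q, z⟩).2 + t • (trivializationAt F Z q ⟨q, s⟩).2 := by
    intro t
    have := ((trivializationAt F Z q).linear ℝ hq)
    rw [this.map_add, this.map_smul]
  refine ⟨?_, ?_⟩
  · rw [FiberBundle.continuousAt_totalSpace]
    refine ⟨continuousAt_const, ?_⟩
    simp only [hlin]
    fun_prop
  · have h : HasFDerivAt (fun t : ℝ ↦ ((extChartAt 𝓘(ℝ, E) q q,
        (trivializationAt F Z q ⟨q, z⟩).2 + t • (trivializationAt F Z q ⟨q, s⟩).2) : E × F))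
        (ContinuousLinearMap.toSpanSingleton ℝ
          ((0, (trivializationAt F Z q ⟨q, s⟩).2) : E × F)) 0 := by
      have h1 : HasDerivAt (fun t : ℝ ↦ (trivializationAt F Z q ⟨q, z⟩).2 +
          t • (trivializationAt F Z q ⟨q, s⟩).2) (trivializationAt F Z q ⟨q, s⟩).2 0 := by
        simpa using ((hasDerivAt_id (0 : ℝ)).smul_const
          (trivializationAt F Z q ⟨q, s⟩).2).const_add (trivializationAt F Z q ⟨q, z⟩).2
      exact ((hasDerivAt_const (0 : ℝ) (extChartAt 𝓘(ℝ, E) q q)).prodMk h1).hasFDerivAt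
    refine HasFDerivAt.hasFDerivWithinAt (h.congr_of_eventuallyEq (.of_forall fun t ↦ ?_))
    simp only [← hlin, writtenInExtChartAt, Function.comp_apply, FiberBundle.extChartAt]
    ext : 1
    · exact congrArg (extChartAt 𝓘(ℝ, E) q)
        (Trivialization.coe_fst' (e := trivializationAt F Z q) hq)
    · rfl

end VectorBundle

/-! ### The inclusion of `M` and nondegeneracy of `Ω_M` on `C` -/

section Constraint

variable {E : Type*} [NormedAddCommGroup E] [NormedSpace ℝ E]
  {Q : Type*} [TopologicalSpace Q] [ChartedSpace E Q] [IsManifold 𝓘(ℝ, E) ∞ Q]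

theorem trivializationAt_cotangent_self (q : Q) (p : TangentSpace 𝓘(ℝ, E) q →L[ℝ] ℝ) :
    (trivializationAt (E →L[ℝ] ℝ) (fun q : Q ↦ TangentSpace 𝓘(ℝ, E) q →L[ℝ] ℝ) q ⟨q, p⟩).2 = p := by
  have h := extChartAt_cotangent_apply (⟨q, p⟩ : CotangentBundle E Q) ⟨q, p⟩
  rw [FiberBundle.extChartAt] at h
  have h2 := congrArg Prod.snd h
  refine Eq.trans h2 ?_
  simp only
  rw [TangentBundle.symmL_trivializationAt_eq_core (mem_chart_source _ _)]
  ext w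
  exact congrArg p ((tangentBundleCore 𝓘(ℝ, E) Q).coordChange_self (achart E q) q
    (mem_chart_source E q) w)

variable {F : Type*} [NormedAddCommGroup F] [NormedSpace ℝ F]
  {D : ∀ q : Q, Submodule ℝ (TangentSpace 𝓘(ℝ, E) q)}
  [TopologicalSpace (ConstraintManifold F D)] [FiberBundle F (fun q : Q ↦ D q)]
  {κ : RiemMetric E Q}

theorem hasMFDerivAt_constrProj {Q : Type*} [TopologicalSpace Q] [ChartedSpace E Q]
    {D : ∀ q : Q, Submodule ℝ (TangentSpace 𝓘(ℝ, E) q)}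
    [TopologicalSpace (ConstraintManifold F D)] [FiberBundle F (fun q : Q ↦ D q)] (m : ConstraintManifold F D) :
    HasMFDerivAt (constrModel E F) 𝓘(ℝ, E) constrProj m (ContinuousLinearMap.fst ℝ E F) :=
  hasMFDerivAt_bundleProj m

theorem mem_distC {Q : Type*} [TopologicalSpace Q] [ChartedSpace E Q]
    {D : ∀ q : Q, Submodule ℝ (TangentSpace 𝓘(ℝ, E) q)}
    [TopologicalSpace (ConstraintManifold F D)] [FiberBundle F (fun q : Q ↦ D q)]
    {m : ConstraintManifold F D} {v : E × F} :
    v ∈ distC m ↔ v.1 ∈ D m.proj := by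
  unfold distC
  rw [(hasMFDerivAt_constrProj m).mfderiv]
  rfl

/-- The metric is a smooth section of `Hom(TQ, T*Q)`, and `ι` applies it to the smooth inclusion `D
→ TQ`. -/
theorem contMDiff_constrIncl (κ : RiemMetric E Q)
    (hincl : ContMDiff (constrModel E F) 𝓘(ℝ, E).tangent ∞ (distIncl (F := F) (D := D))) :
    ContMDiff (constrModel E F) (cotModel E) ∞ (constrIncl (F := F) (D := D) κ) := by
  have h1 := κ.contMDiff.comp (contMDiff_proj (F := F) (IB := 𝓘(ℝ, E)) (n := ∞) (fun q : Q ↦ D q))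
  exact ContMDiff.clm_bundle_apply h1 hincl

theorem hasMFDerivAt_constrIncl
    (hincl : ContMDiff (constrModel E F) 𝓘(ℝ, E).tangent ∞ (distIncl (F := F) (D := D)))
    (m : ConstraintManifold F D) :
    HasMFDerivAt (constrModel E F) (cotModel E) (constrIncl κ) m (inclDeriv κ m) :=
  ((contMDiff_constrIncl κ hincl).mdifferentiable (by simp) m).hasMFDerivAt

/-- Differentiate `τ_Q ∘ ι = τ_M`, both projections having derivative `fst` in charts. -/
theorem inclDeriv_fst
    (hincl : ContMDiff (constrModel E F) 𝓘(ℝ, E).tangent ∞ (distIncl (F := F) (D := D)))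
    (m : ConstraintManifold F D) (u : E × F) :
    (show E × (E →L[ℝ] ℝ) from inclDeriv κ m u).1 = u.1 := by
  have h := (hasMFDerivAt_bundleProj (constrIncl κ m)).comp m (hasMFDerivAt_constrIncl hincl m)
  exact congrArg (fun T : E × F →L[ℝ] E ↦ T u)
    (hasMFDerivAt_unique h (hasMFDerivAt_bundleProj m))

/-- The derivative of the inclusion in a vertical direction. -/
theorem inclDeriv_vertical [VectorBundle ℝ F (fun q : Q ↦ D q)]
    (hincl : ContMDiff (constrModel E F) 𝓘(ℝ, E).tangent ∞ (distIncl (F := F) (D := D)))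
    (m : ConstraintManifold F D)
    (s : D m.proj) :
    inclDeriv κ m ((0, (trivializationAt F (fun q : Q ↦ D q) m.proj ⟨m.proj, s⟩).2) : E × F) =
      ((0, κ.inner m.proj s) : E × (E →L[ℝ] ℝ)) := by
  obtain ⟨q, z⟩ := m
  -- The base point `z + 0 • s` equals `z` only propositionally, so the derivative is transported to
  -- every equal point. The same device is used for the group action below.
  have hx : ∀ x : ConstraintManifold F D, x = ⟨q, z⟩ →
      HasMFDerivAt (constrModel E F) (cotModel E) (constrIncl κ) x
        (show E × F →L[ℝ] E × (E →L[ℝ] ℝ) from inclDeriv κ ⟨q, z⟩) := by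
    rintro x rfl
    exact hasMFDerivAt_constrIncl hincl _
  -- `ι` is linear on fibres, so it carries the line `z + t s` to the line `κ(z) + t κ(s)`; compare
  -- velocities.
  have h1 := (hx ⟨q, z + (0 : ℝ) • s⟩ (by simp)).comp (0 : ℝ)
    (hasMFDerivAt_fibreLine (E := E) (F := F) (Z := fun q : Q ↦ D q) q z s)
  have h2 := hasMFDerivAt_fibreLine (E := E) (F := E →L[ℝ] ℝ)
    (Z := fun q : Q ↦ TangentSpace 𝓘(ℝ, E) q →L[ℝ] ℝ) q (κ.inner q z) (κ.inner q s)
  rw [trivializationAt_cotangent_self] at h2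
  have h3 := hasMFDerivAt_unique h1 (h2.congr_of_eventuallyEq (.of_forall fun t ↦ by
    simp [constrIncl]))
  have h4 := congrArg (fun T : ℝ →L[ℝ] E × (E →L[ℝ] ℝ) ↦ T 1) h3
  refine Eq.trans ?_ (h4.trans ?_)
  · exact congrArg (show E × F →L[ℝ] E × (E →L[ℝ] ℝ) from inclDeriv κ ⟨q, z⟩) (one_smul ℝ _).symm
  · exact one_smul ℝ ((0, κ.inner q s) : E × (E →L[ℝ] ℝ))

theorem omegaM_apply
    (hincl : ContMDiff (constrModel E F) 𝓘(ℝ, E).tangent ∞ (distIncl (F := F) (D := D)))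
    (m : ConstraintManifold F D) (v w : E × F) :
    OmegaM κ m v w = (show E × (E →L[ℝ] ℝ) from inclDeriv κ m w).2 v.1 -
      (show E × (E →L[ℝ] ℝ) from inclDeriv κ m v).2 w.1 := by
  refine (omega_apply (constrIncl κ m) (inclDeriv κ m v) (inclDeriv κ m w)).trans ?_
  have h1 := inclDeriv_fst (κ := κ) hincl m v
  have h2 := inclDeriv_fst (κ := κ) hincl m w
  exact congrArg₂ (· - ·) (congrArg _ h1) (congrArg _ h2)

/-- The restriction of `Ω_M` to `C` is nondegenerate. -/
theorem omegaM_nondegenerate [VectorBundle ℝ F (fun q : Q ↦ D q)]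
    (hincl : ContMDiff (constrModel E F) 𝓘(ℝ, E).tangent ∞ (distIncl (F := F) (D := D)))
    (m : ConstraintManifold F D)
    (v : TangentSpace (constrModel E F) m) (hv : v ∈ distC m)
    (h : ∀ w ∈ distC m, OmegaM κ m v w = 0) : v = 0 := by
  let e := trivializationAt F (fun q : Q ↦ D q) m.proj
  have hq : m.proj ∈ e.baseSet := FiberBundle.mem_baseSet_trivializationAt' m.proj
  have hsurj : ∀ b : F, ∃ s : D m.proj, (e ⟨m.proj, s⟩).2 = b := fun b ↦
    ⟨(e.continuousLinearEquivAt ℝ m.proj hq).symm b,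
      (e.continuousLinearEquivAt ℝ m.proj hq).apply_symm_apply b⟩
  obtain ⟨a, b⟩ : E × F := v
  obtain ⟨s, rfl⟩ := hsurj b
  have ha : a ∈ D m.proj := mem_distC.1 hv
  have hpos : ∀ u : TangentSpace 𝓘(ℝ, E) m.proj, κ.inner m.proj u u = 0 → u = 0 := fun u hu ↦ by
    by_contra hne
    exact (κ.pos m.proj u hne).ne' hu
  have h1 : a = 0 := by
    -- A vertical test vector whose fibre part is `a` itself; the pairing is `κ(a, a)`.
    let w : E × F := (0, (e ⟨m.proj, ⟨a, ha⟩⟩).2)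
    have hw := h w (mem_distC.2 (D m.proj).zero_mem)
    rw [omegaM_apply hincl] at hw
    have hw2 := congrArg Prod.snd (inclDeriv_vertical (κ := κ) hincl m ⟨a, ha⟩)
    have hw3 : (show E × (E →L[ℝ] ℝ) from inclDeriv κ m w).2 = κ.inner m.proj a := hw2
    simp only [w, map_zero, sub_zero] at hw hw3
    rw [hw3] at hw
    exact hpos a hw
  subst h1
  have h2 : (s : TangentSpace 𝓘(ℝ, E) m.proj) = 0 := by
    -- Now `v` is vertical with fibre part `s`. Any test vector over `s` lies in `C` and pairs with
    -- `v` to `-κ(s, s)`, whatever its fibre part.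
    let w : E × F := (s.1, 0)
    have hw := h w (mem_distC.2 s.2)
    rw [omegaM_apply hincl] at hw
    have hw2 := congrArg Prod.snd (inclDeriv_vertical (κ := κ) hincl m s)
    have hw3 : (show E × (E →L[ℝ] ℝ) from inclDeriv κ m
      ((0, (e ⟨m.proj, s⟩).2) : E × F)).2 = κ.inner m.proj s := hw2
    simp only [map_zero, zero_sub, neg_eq_zero] at hw
    rw [hw3] at hw
    exact hpos s hw
  have h3 : (e ⟨m.proj, s⟩).2 = 0 := by
    have : s = 0 := Subtype.ext h2
    rw [this]
    exact map_zero (e.continuousLinearEquivAt ℝ m.proj hq)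
  rw [h3]
  rfl

end Constraint

/-! ### The action in charts -/

section LocalAction

variable {E : Type*} [NormedAddCommGroup E] [NormedSpace ℝ E]
  {Q : Type*} [TopologicalSpace Q] [ChartedSpace E Q]
  {EG : Type*} [NormedAddCommGroup EG] [NormedSpace ℝ EG]
  {G : Type*} [TopologicalSpace G] [ChartedSpace EG G] [Group G] [MulAction G Q]

/-- The action read in the preferred charts at `1 : G` and at `q : Q`. -/
def localAction (E EG G : Type*) [NormedAddCommGroup E] [NormedSpace ℝ E] [NormedAddCommGroup EG]
    [NormedSpace ℝ EG] {Q : Type*} [TopologicalSpace Q] [ChartedSpace E Q]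
    [TopologicalSpace G] [ChartedSpace EG G] [Group G] [MulAction G Q] (q : Q) (z : EG × E) : E :=
  extChartAt 𝓘(ℝ, E) q
    ((extChartAt 𝓘(ℝ, EG) (1 : G)).symm z.1 • (extChartAt 𝓘(ℝ, E) q).symm z.2)

/-- The point of `EG × E` that represents `(1, q)`. -/
def localOrigin (E EG G : Type*) [NormedAddCommGroup E] [NormedSpace ℝ E] [NormedAddCommGroup EG]
    [NormedSpace ℝ EG] {Q : Type*} [TopologicalSpace Q] [ChartedSpace E Q]
    [TopologicalSpace G] [ChartedSpace EG G] [Group G] (q : Q) : EG × E :=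
  (extChartAt 𝓘(ℝ, EG) (1 : G) 1, extChartAt 𝓘(ℝ, E) q q)

theorem mdifferentiable_smul_left (EG) [NormedAddCommGroup EG] [NormedSpace ℝ EG] [ChartedSpace EG G]
    [ContMDiffSMul 𝓘(ℝ, EG) 𝓘(ℝ, E) ∞ G Q] (g : G) :
    MDifferentiable 𝓘(ℝ, E) 𝓘(ℝ, E) (fun x : Q ↦ g • x) :=
  ((ContMDiffSMul.contMDiff_smul (I := 𝓘(ℝ, EG)) (I' := 𝓘(ℝ, E)) (n := ∞) (G := G)
      (M := Q)).comp (contMDiff_const.prodMk contMDiff_id)).mdifferentiable (by simp)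

theorem mdifferentiable_smul_right (E EG) [NormedAddCommGroup E] [NormedSpace ℝ E] [ChartedSpace E Q]
    [NormedAddCommGroup EG] [NormedSpace ℝ EG] [ChartedSpace EG G]
    [ContMDiffSMul 𝓘(ℝ, EG) 𝓘(ℝ, E) ∞ G Q] (q : Q) :
    MDifferentiable 𝓘(ℝ, EG) 𝓘(ℝ, E) (fun g : G ↦ g • q) :=
  ((ContMDiffSMul.contMDiff_smul (I := 𝓘(ℝ, EG)) (I' := 𝓘(ℝ, E)) (n := ∞) (G := G)
      (M := Q)).comp (contMDiff_id.prodMk contMDiff_const)).mdifferentiable (by simp)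

theorem tendsto_smul_nhds_one (E EG) [NormedAddCommGroup E] [NormedSpace ℝ E] [ChartedSpace E Q]
    [NormedAddCommGroup EG] [NormedSpace ℝ EG] [ChartedSpace EG G]
    [ContMDiffSMul 𝓘(ℝ, EG) 𝓘(ℝ, E) ∞ G Q] (q : Q) :
    Filter.Tendsto (fun g : G ↦ g • q) (𝓝 1) (𝓝 q) := by
  have h := (mdifferentiable_smul_right E EG (G := G) q).continuous.tendsto 1
  simpa using h

variable [IsManifold 𝓘(ℝ, E) ∞ Q]

theorem hasMFDerivAt_extChartAt_self {V : Type*} [NormedAddCommGroup V] [NormedSpace ℝ V]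
    {H : Type*} [TopologicalSpace H] {J : ModelWithCorners ℝ V H}
    {N : Type*} [TopologicalSpace N] [ChartedSpace H N] [IsManifold J 1 N] (x : N) :
    HasMFDerivAt J 𝓘(ℝ, V) (extChartAt J x) x (ContinuousLinearMap.id ℝ V) := by
  have h := (mdifferentiableAt_extChartAt (I := J) (mem_chart_source H x)).hasMFDerivAt
  rw [mfderiv_extChartAt_self] at h
  exact h

theorem hasMFDerivAt_extChartAt_symm_self {V : Type*} [NormedAddCommGroup V] [NormedSpace ℝ V]
    {N : Type*} [TopologicalSpace N] [ChartedSpace V N] [IsManifold 𝓘(ℝ, V) 1 N] (x : N) :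
    HasMFDerivAt 𝓘(ℝ, V) 𝓘(ℝ, V) (extChartAt 𝓘(ℝ, V) x).symm (extChartAt 𝓘(ℝ, V) x x)
      (ContinuousLinearMap.id ℝ V) := by
  have h := (mdifferentiableWithinAt_extChartAt_symm (I := 𝓘(ℝ, V))
    (mem_extChartAt_target x)).hasMFDerivWithinAt
  rw [mfderivWithin_range_extChartAt_symm, ModelWithCorners.range_eq_univ] at h
  exact hasMFDerivWithinAt_univ.1 h

theorem trivializationAt_tangent_snd {q₀ q : Q} (hq : q ∈ (chartAt E q₀).source)
    (v : TangentSpace 𝓘(ℝ, E) q) :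
    (trivializationAt E (TangentSpace 𝓘(ℝ, E)) q₀ ⟨q, v⟩).2 =
      mfderiv 𝓘(ℝ, E) 𝓘(ℝ, E) (extChartAt 𝓘(ℝ, E) q₀) q v := by
  rw [← TangentBundle.continuousLinearMapAt_trivializationAt hq]
  exact (congrFun (Trivialization.coe_linearMapAt_of_mem (R := ℝ)
    (trivializationAt E (TangentSpace 𝓘(ℝ, E)) q₀) hq) v).symm

variable [IsManifold 𝓘(ℝ, EG) ∞ G] [ContMDiffSMul 𝓘(ℝ, EG) 𝓘(ℝ, E) ∞ G Q]

theorem contDiffAt_localAction (q : Q) :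
    ContDiffAt ℝ ∞ (localAction E EG G q) (localOrigin E EG G q) := by
  rw [← contMDiffAt_iff_contDiffAt]
  have h1 : ContMDiffAt 𝓘(ℝ, EG × E) 𝓘(ℝ, EG) ∞
      (fun z : EG × E ↦ (extChartAt 𝓘(ℝ, EG) (1 : G)).symm z.1) (localOrigin E EG G q) := by
    have h := contMDiffOn_extChartAt_symm (I := 𝓘(ℝ, EG)) (n := ∞) (1 : G)
    have h' := h.contMDiffAt (x := extChartAt 𝓘(ℝ, EG) (1 : G) 1)
      (extChartAt_target_mem_nhds (1 : G))
    exact h'.comp (localOrigin E EG G q) contDiff_fst.contMDiff.contMDiffAt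
  have h2 : ContMDiffAt 𝓘(ℝ, EG × E) 𝓘(ℝ, E) ∞
      (fun z : EG × E ↦ (extChartAt 𝓘(ℝ, E) q).symm z.2) (localOrigin E EG G q) := by
    have h := contMDiffOn_extChartAt_symm (I := 𝓘(ℝ, E)) (n := ∞) q
    have h' := h.contMDiffAt (x := extChartAt 𝓘(ℝ, E) q q) (extChartAt_target_mem_nhds q)
    exact h'.comp (localOrigin E EG G q) contDiff_snd.contMDiff.contMDiffAt
  have h3 := (ContMDiffSMul.contMDiff_smul (I := 𝓘(ℝ, EG)) (I' := 𝓘(ℝ, E)) (n := ∞) (G := G)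
      (M := Q)).contMDiffAt.comp (localOrigin E EG G q) (h1.prodMk h2)
  refine ContMDiffAt.comp (I' := 𝓘(ℝ, E)) (localOrigin E EG G q)
    (g := extChartAt 𝓘(ℝ, E) q) ?_ h3
  have h4 : (extChartAt 𝓘(ℝ, EG) (1 : G)).symm (localOrigin E EG G q).1 •
      (extChartAt 𝓘(ℝ, E) q).symm (localOrigin E EG G q).2 = q := by
    simp [localOrigin]
  change ContMDiffAt _ _ _ _ ((extChartAt 𝓘(ℝ, EG) (1 : G)).symm (localOrigin E EG G q).1 •
      (extChartAt 𝓘(ℝ, E) q).symm (localOrigin E EG G q).2)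
  rw [h4]
  exact contMDiffAt_extChartAt

theorem contDiffAt_two_localAction (q : Q) :
    ContDiffAt ℝ 2 (localAction E EG G q) (localOrigin E EG G q) :=
  contDiffAt_infty.1 (contDiffAt_localAction q) 2

theorem eventually_differentiableAt_localAction (q : Q) :
    ∀ᶠ z in 𝓝 (localOrigin E EG G q), DifferentiableAt ℝ (localAction E EG G q) z := by
  filter_upwards [(contDiffAt_two_localAction q).eventually (by simp)] with z hz
  exact hz.differentiableAt (by simp)

/-- The tangent lift of the action in charts. -/
theorem eventually_tangentAct_eq (q : Q) :
    ∀ᶠ g : G in 𝓝 1, ∀ a : E,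
      (trivializationAt E (TangentSpace 𝓘(ℝ, E)) q ⟨g • q, tangentAct g q a⟩).2 =
        fderiv ℝ (localAction E EG G q) (extChartAt 𝓘(ℝ, EG) (1 : G) g, extChartAt 𝓘(ℝ, E) q q)
          (0, a) := by
  have h1 : ∀ᶠ g : G in 𝓝 1, DifferentiableAt ℝ (localAction E EG G q)
      (extChartAt 𝓘(ℝ, EG) (1 : G) g, extChartAt 𝓘(ℝ, E) q q) := by
    have hc : ContinuousAt (fun g : G ↦ ((extChartAt 𝓘(ℝ, EG) (1 : G) g,
        extChartAt 𝓘(ℝ, E) q q) : EG × E)) 1 :=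
      (continuousAt_extChartAt (1 : G)).prodMk continuousAt_const
    exact hc.eventually (eventually_differentiableAt_localAction q)
  have h2 : ∀ᶠ g : G in 𝓝 1, g • q ∈ (chartAt E q).source :=
    (tendsto_smul_nhds_one E EG q).eventually
      ((chartAt E q).open_source.mem_nhds (mem_chart_source E q))
  filter_upwards [h1, h2, extChartAt_source_mem_nhds (I := 𝓘(ℝ, EG)) (1 : G)] with g hg1 hg2 hg3 a
  rw [trivializationAt_tangent_snd hg2]
  have hs : (extChartAt 𝓘(ℝ, E) q).symm (extChartAt 𝓘(ℝ, E) q q) = q := extChartAt_to_inv q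
  have hx : ∀ x : Q, x = q → HasMFDerivAt 𝓘(ℝ, E) 𝓘(ℝ, E) (fun x : Q ↦ g • x) x
      (show E →L[ℝ] E from tangentAct g q) := by
    rintro x rfl
    exact (mdifferentiable_smul_left EG g x).hasMFDerivAt
  have hy : ∀ x : Q, x = q → HasMFDerivAt 𝓘(ℝ, E) 𝓘(ℝ, E) (extChartAt 𝓘(ℝ, E) q) (g • x)
      (show E →L[ℝ] E from mfderiv 𝓘(ℝ, E) 𝓘(ℝ, E) (extChartAt 𝓘(ℝ, E) q) (g • q)) := by
    rintro x rfl
    exact (mdifferentiableAt_extChartAt hg2).hasMFDerivAt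
  -- The slice `x ↦ φ(g, x)` of the local action is differentiated once through the manifold and
  -- once as a partial derivative of `φ`.
  have hA := (hx _ hs).comp _ (hasMFDerivAt_extChartAt_symm_self q)
  have hB := (hy _ hs).comp (extChartAt 𝓘(ℝ, E) q q) hA
  have hC := hg1.hasFDerivAt.comp (extChartAt 𝓘(ℝ, E) q q)
    (hasFDerivAt_prodMk_right (𝕜 := ℝ) (extChartAt 𝓘(ℝ, EG) (1 : G) g) (extChartAt 𝓘(ℝ, E) q q))
  have hD := hasMFDerivAt_unique hB (hC.hasMFDerivAt.congr_of_eventuallyEq (.of_forall fun x ↦ by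
    simp only [localAction, Function.comp_apply, (extChartAt 𝓘(ℝ, EG) (1 : G)).left_inv hg3]))
  exact congrArg (fun T : E →L[ℝ] E ↦ T a) hD

/-- The infinitesimal generators in charts. -/
theorem eventually_genQ_eq (q₀ : Q) :
    ∀ᶠ q in 𝓝 q₀, ∀ η : GroupLieAlgebra 𝓘(ℝ, EG) G,
      (trivializationAt E (TangentSpace 𝓘(ℝ, E)) q₀ ⟨q, genQ q η⟩).2 =
        fderiv ℝ (localAction E EG G q₀)
          (extChartAt 𝓘(ℝ, EG) (1 : G) 1, extChartAt 𝓘(ℝ, E) q₀ q) ((η : EG), 0) := by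
  have h1 : ∀ᶠ q in 𝓝 q₀, DifferentiableAt ℝ (localAction E EG G q₀)
      (extChartAt 𝓘(ℝ, EG) (1 : G) 1, extChartAt 𝓘(ℝ, E) q₀ q) := by
    have hc : ContinuousAt (fun q : Q ↦ ((extChartAt 𝓘(ℝ, EG) (1 : G) 1,
        extChartAt 𝓘(ℝ, E) q₀ q) : EG × E)) q₀ :=
      continuousAt_const.prodMk (continuousAt_extChartAt q₀)
    exact hc.eventually (eventually_differentiableAt_localAction q₀)
  filter_upwards [h1, extChartAt_source_mem_nhds (I := 𝓘(ℝ, E)) q₀] with q hq1 hq2 η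
  rw [extChartAt_source] at hq2
  rw [trivializationAt_tangent_snd hq2]
  have hs : (extChartAt 𝓘(ℝ, EG) (1 : G)).symm (extChartAt 𝓘(ℝ, EG) (1 : G) 1) = 1 :=
    extChartAt_to_inv 1
  have hx : ∀ g : G, g = 1 → HasMFDerivAt 𝓘(ℝ, EG) 𝓘(ℝ, E) (fun g : G ↦ g • q) g
      (show EG →L[ℝ] E from genQ (G := G) q) := by
    rintro x rfl
    exact (mdifferentiable_smul_right E EG q 1).hasMFDerivAt
  have hy : ∀ g : G, g = 1 → HasMFDerivAt 𝓘(ℝ, E) 𝓘(ℝ, E) (extChartAt 𝓘(ℝ, E) q₀) (g • q)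
      (show E →L[ℝ] E from mfderiv 𝓘(ℝ, E) 𝓘(ℝ, E) (extChartAt 𝓘(ℝ, E) q₀) q) := by
    rintro x rfl
    rw [one_smul]
    exact (mdifferentiableAt_extChartAt hq2).hasMFDerivAt
  have hA := (hx _ hs).comp _ (hasMFDerivAt_extChartAt_symm_self (1 : G))
  have hB := (hy _ hs).comp (extChartAt 𝓘(ℝ, EG) (1 : G) 1) hA
  have hC := hq1.hasFDerivAt.comp (extChartAt 𝓘(ℝ, EG) (1 : G) 1)
    (hasFDerivAt_prodMk_left (𝕜 := ℝ) (extChartAt 𝓘(ℝ, EG) (1 : G) 1) (extChartAt 𝓘(ℝ, E) q₀ q))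
  have hD := hasMFDerivAt_unique hB (hC.hasMFDerivAt.congr_of_eventuallyEq (.of_forall fun x ↦ by
    simp [localAction, (chartAt E q₀).left_inv hq2]))
  exact congrArg (fun T : EG →L[ℝ] E ↦ T η) hD

end LocalAction

/-! ### Second derivative of the action and differential of the momentum -/

section Generators

variable {E : Type*} [NormedAddCommGroup E] [NormedSpace ℝ E]
  {Q : Type*} [TopologicalSpace Q] [ChartedSpace E Q] [IsManifold 𝓘(ℝ, E) ∞ Q]
  {EG : Type*} [NormedAddCommGroup EG] [NormedSpace ℝ EG]
  {G : Type*} [TopologicalSpace G] [ChartedSpace EG G] [Group G] [MulAction G Q]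

/-- The pairing of covectors and vectors in charts. -/
theorem snd_extChartAt_cotangent_apply (α β : CotangentBundle E Q)
    (hβ : β.proj ∈ (chartAt E α.proj).source) (v : TangentSpace 𝓘(ℝ, E) β.proj) :
    (extChartAt (cotModel E) α β).2
      (trivializationAt E (TangentSpace 𝓘(ℝ, E)) α.proj ⟨β.proj, v⟩).2 = β.snd v := by
  rw [extChartAt_cotangent_apply]
  have h := Trivialization.symmL_continuousLinearMapAt (R := ℝ)
    (trivializationAt E (TangentSpace 𝓘(ℝ, E)) α.proj) hβ v
  rw [Trivialization.continuousLinearMapAt_apply_of_mem ℝ _ hβ] at h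
  exact congrArg β.snd h

theorem snd_extChartAt_cotangent_self (α : CotangentBundle E Q) :
    (extChartAt (cotModel E) α α).2 = α.snd := by
  rw [FiberBundle.extChartAt]
  exact trivializationAt_cotangent_self α.proj α.snd

theorem hasFDerivAt_fderiv_apply {V W : Type*} [NormedAddCommGroup V] [NormedSpace ℝ V]
    [NormedAddCommGroup W] [NormedSpace ℝ W] {φ : V → W} {z : V} (h : ContDiffAt ℝ 2 φ z) (c : V) :
    HasFDerivAt (fun y ↦ fderiv ℝ φ y c) ((fderiv ℝ (fderiv ℝ φ) z).flip c) z := by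
  have h1 : DifferentiableAt ℝ (fderiv ℝ φ) z :=
    (h.fderiv_right (m := 1) (by norm_num)).differentiableAt (by simp)
  exact h1.hasFDerivAt.clm_apply (hasFDerivAt_const c z) |>.congr_fderiv (by ext; simp)

variable [IsManifold 𝓘(ℝ, EG) ∞ G] [ContMDiffSMul 𝓘(ℝ, EG) 𝓘(ℝ, E) ∞ G Q]

/-- In the chart at `q`, the second derivative of the action at `(1, q)`. -/
def secondDeriv (E EG G : Type*) [NormedAddCommGroup E] [NormedSpace ℝ E] [NormedAddCommGroup EG]
    [NormedSpace ℝ EG] {Q : Type*} [TopologicalSpace Q] [ChartedSpace E Q] [TopologicalSpace G]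
    [ChartedSpace EG G] [Group G] [MulAction G Q] (q : Q) : EG × E →L[ℝ] EG × E →L[ℝ] E :=
  fderiv ℝ (fderiv ℝ (localAction E EG G q)) (localOrigin E EG G q)

/-- With arguments `(0, a), (η, 0)` this differentiates the generator `η_Q` along `Q`; in the other
order it differentiates the tangent lift along `G`. Their equality links the momentum to the lifted
action. -/
theorem secondDeriv_symm (q : Q) (v w : EG × E) :
    secondDeriv E EG G q v w = secondDeriv E EG G q w v :=
  ((contDiffAt_two_localAction q).isSymmSndFDerivAt (by simp)) v w

theorem genQ_eq_fderiv (q : Q) (η : GroupLieAlgebra 𝓘(ℝ, EG) G) :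
    fderiv ℝ (localAction E EG G q) (localOrigin E EG G q) ((η : EG), 0) = genQ q η := by
  refine ((eventually_genQ_eq q).self_of_nhds η).symm.trans ?_
  rw [trivializationAt_tangent_snd (mem_chart_source E q)]
  exact congrArg (fun T : E →L[ℝ] E ↦ T (genQ q η)) mfderiv_extChartAt_self

theorem exists_hasFDerivAt_pairing {W : Type*} [NormedAddCommGroup W] [NormedSpace ℝ W]
    (j : W →L[ℝ] E →L[ℝ] ℝ) {Z : E → E} {Z' : E →L[ℝ] E} {y : E × W} (hZ : HasFDerivAt Z Z' y.1) :
    ∃ T : E × W →L[ℝ] ℝ, HasFDerivAt (fun y : E × W ↦ j y.2 (Z y.1)) T y ∧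
      ∀ u, T u = j u.2 (Z y.1) + j y.2 (Z' u.1) := by
  have h1 : HasFDerivAt (fun y : E × W ↦ j y.2) (j.comp (ContinuousLinearMap.snd ℝ E W)) y :=
    j.hasFDerivAt.comp y hasFDerivAt_snd
  have h2 : HasFDerivAt (fun y : E × W ↦ Z y.1) (Z'.comp (ContinuousLinearMap.fst ℝ E W)) y :=
    hZ.comp y hasFDerivAt_fst
  refine ⟨_, h1.clm_apply h2, fun u ↦ ?_⟩
  simp [add_comm]

/-- The derivative of the momentum `α ↦ α(η_Q)` in the preferred charts. -/
theorem exists_hasMFDerivAt_linearFunction_genQ (η : GroupLieAlgebra 𝓘(ℝ, EG) G)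
    (α : CotangentBundle E Q) :
    ∃ T : TangentSpace (cotModel E) α →L[ℝ] ℝ,
      HasMFDerivAt (cotModel E) 𝓘(ℝ, ℝ) (linearFunction (fun q : Q ↦ genQ q η)) α T ∧
      ∀ u : E × (E →L[ℝ] ℝ), T u = u.2 (genQ α.proj η) +
        α.snd (secondDeriv E EG G α.proj (0, u.1) ((η : EG), 0)) := by
  let c : EG × E := (η, 0)
  -- The local representative of `η_Q`, so that the momentum becomes `(x, p) ↦ p(Z(x))`.
  let Z : E → E := fun x ↦ fderiv ℝ (localAction E EG G α.proj)
    (extChartAt 𝓘(ℝ, EG) (1 : G) 1, x) c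
  have hZ : HasFDerivAt Z (((secondDeriv E EG G α.proj).flip c).comp
      (ContinuousLinearMap.inr ℝ EG E)) (extChartAt 𝓘(ℝ, E) α.proj α.proj) :=
    (hasFDerivAt_fderiv_apply (contDiffAt_two_localAction α.proj) c).comp
      (extChartAt 𝓘(ℝ, E) α.proj α.proj)
      (hasFDerivAt_prodMk_right (𝕜 := ℝ) (extChartAt 𝓘(ℝ, EG) (1 : G) 1)
        (extChartAt 𝓘(ℝ, E) α.proj α.proj))
  have hfst : (extChartAt (cotModel E) α α).1 = extChartAt 𝓘(ℝ, E) α.proj α.proj := by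
    rw [extChartAt_cotangent_apply]
  rw [← hfst] at hZ
  obtain ⟨T, hT, hTu⟩ := exists_hasFDerivAt_pairing
    (ContinuousLinearMap.id ℝ (E →L[ℝ] ℝ)) (y := extChartAt (cotModel E) α α) hZ
  refine ⟨T, ?_, fun u ↦ ?_⟩
  · have h := hT.hasMFDerivAt.comp α (hasMFDerivAt_extChartAt_self (J := cotModel E) α)
    refine (h.congr_of_eventuallyEq ?_)
    have hev : ∀ᶠ β : CotangentBundle E Q in 𝓝 α, _ :=
      (FiberBundle.continuous_proj (E →L[ℝ] ℝ)
        (fun q : Q ↦ TangentSpace 𝓘(ℝ, E) q →L[ℝ] ℝ)).continuousAt.eventually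
        ((eventually_genQ_eq (E := E) (EG := EG) (G := G) α.proj).and
          ((chartAt E α.proj).open_source.mem_nhds (mem_chart_source E α.proj)))
    filter_upwards [hev] with β hβ
    refine (snd_extChartAt_cotangent_apply α β hβ.2 (genQ β.proj η)).symm.trans ?_
    rw [hβ.1 η, Function.comp_apply]
    have hb : (extChartAt (cotModel E) α β).1 = extChartAt 𝓘(ℝ, E) α.proj β.proj := by
      rw [extChartAt_cotangent_apply]
    rw [hb]
    rfl
  · refine (hTu u).trans ?_
    rw [hfst, snd_extChartAt_cotangent_self]
    refine congrArg₂ (· + ·) ?_ rfl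
    exact congrArg u.2 (genQ_eq_fderiv α.proj η)

end Generators

/-! ### Differentiability of the orbit maps in `M` -/

section ConstraintAction

variable {E : Type*} [NormedAddCommGroup E] [NormedSpace ℝ E]
  {Q : Type*} [TopologicalSpace Q] [ChartedSpace E Q] [IsManifold 𝓘(ℝ, E) ∞ Q]
  {EG : Type*} [NormedAddCommGroup EG] [NormedSpace ℝ EG]
  {G : Type*} [TopologicalSpace G] [ChartedSpace EG G] [Group G] [MulAction G Q]
  {F : Type*} [NormedAddCommGroup F] [NormedSpace ℝ F]
  {D : ∀ q : Q, Submodule ℝ (TangentSpace 𝓘(ℝ, E) q)}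
  [TopologicalSpace (ConstraintManifold F D)] [FiberBundle F (fun q : Q ↦ D q)]
  [VectorBundle ℝ F (fun q : Q ↦ D q)]

theorem constrAct_one {Q : Type*} [TopologicalSpace Q] [ChartedSpace E Q]
    {G : Type*} [Group G] [MulAction G Q] {F : Type*}
    {D : ∀ q : Q, Submodule ℝ (TangentSpace 𝓘(ℝ, E) q)} (hD : DistInvariant G D) (m : ConstraintManifold F D) :
    constrAct hD 1 m = m := by
  -- All fibres of `TQ` are the model space `E`, so vectors over `1 • q` and `q` can be compared
  -- without a cast.
  have hmk : ∀ (q : Q) (v w : E) (hv : v ∈ D m.proj) (hw : w ∈ D q), q = m.proj → w = v →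
      (⟨q, ⟨w, hw⟩⟩ : ConstraintManifold F D) = ⟨m.proj, ⟨v, hv⟩⟩ := by
    rintro q v w hv hw rfl rfl
    rfl
  refine hmk _ _ _ m.snd.2 _ (one_smul G m.proj) ?_
  have h1 := (hasMFDerivAt_id (I := 𝓘(ℝ, E)) m.proj).congr_of_eventuallyEq
    (f₁ := fun x : Q ↦ (1 : G) • x) (.of_forall fun x ↦ by simp)
  exact congrArg (fun T : E →L[ℝ] E ↦ T m.snd.1) h1.mfderiv

theorem finiteDimensional_modelFibre {Q : Type*} [TopologicalSpace Q] [ChartedSpace E Q]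
    {D : ∀ q : Q, Submodule ℝ (TangentSpace 𝓘(ℝ, E) q)} [FiniteDimensional ℝ E] (q : Q) (F : Type*) [NormedAddCommGroup F] [NormedSpace ℝ F]
    [TopologicalSpace (ConstraintManifold F D)] [FiberBundle F (fun q : Q ↦ D q)]
    [VectorBundle ℝ F (fun q : Q ↦ D q)] : FiniteDimensional ℝ F := by
  have : FiniteDimensional ℝ (TangentSpace 𝓘(ℝ, E) q) := inferInstanceAs (FiniteDimensional ℝ E)
  exact ((trivializationAt F (fun q : Q ↦ D q) q).continuousLinearEquivAt ℝ q
    (FiberBundle.mem_baseSet_trivializationAt' q)).toLinearEquiv.finiteDimensional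

/-- The inclusion `D → TQ` read in the trivializations at `q₀`. -/
def localIncl (F : Type*) [NormedAddCommGroup F] [NormedSpace ℝ F]
    {D : ∀ q : Q, Submodule ℝ (TangentSpace 𝓘(ℝ, E) q)}
    [TopologicalSpace (ConstraintManifold F D)] [FiberBundle F (fun q : Q ↦ D q)]
    [VectorBundle ℝ F (fun q : Q ↦ D q)] (q₀ q : Q) : F →L[ℝ] E :=
  ((trivializationAt E (TangentSpace 𝓘(ℝ, E)) q₀).continuousLinearMapAt ℝ q).comp
    ((D q).subtypeL.comp ((trivializationAt F (fun q : Q ↦ D q) q₀).symmL ℝ q))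

theorem localIncl_apply {q₀ q : Q} (hT : q ∈ (chartAt E q₀).source) (u : F) :
    localIncl F (D := D) q₀ q u = (trivializationAt E (TangentSpace 𝓘(ℝ, E)) q₀
      ⟨q, (trivializationAt F (fun q : Q ↦ D q) q₀).symmL ℝ q u⟩).2 :=
  Trivialization.continuousLinearMapAt_apply_of_mem ℝ
    (trivializationAt E (TangentSpace 𝓘(ℝ, E)) q₀) hT _

theorem localIncl_trivialization {q₀ q : Q} (hT : q ∈ (chartAt E q₀).source)
    (hF : q ∈ (trivializationAt F (fun q : Q ↦ D q) q₀).baseSet) (s : D q) :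
    localIncl F (D := D) q₀ q (trivializationAt F (fun q : Q ↦ D q) q₀ ⟨q, s⟩).2 =
      (trivializationAt E (TangentSpace 𝓘(ℝ, E)) q₀ ⟨q, s⟩).2 := by
  rw [localIncl_apply hT, ← Trivialization.continuousLinearMapAt_apply_of_mem ℝ _ hF,
    Trivialization.symmL_continuousLinearMapAt _ hF]

theorem localIncl_injective (q₀ : Q) : Function.Injective (localIncl F (D := D) q₀ q₀) := by
  have hF := FiberBundle.mem_baseSet_trivializationAt' (F := F) (E := fun q : Q ↦ D q) q₀
  let eF := (trivializationAt F (fun q : Q ↦ D q) q₀).continuousLinearEquivAt ℝ q₀ hF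
  let eT := (trivializationAt E (TangentSpace 𝓘(ℝ, E)) q₀).continuousLinearEquivAt ℝ q₀
    (mem_chart_source E q₀)
  intro u u' h
  obtain ⟨s, rfl⟩ := eF.surjective u
  obtain ⟨s', rfl⟩ := eF.surjective u'
  have h1 := (localIncl_trivialization (mem_chart_source E q₀) hF s).symm.trans
    (Eq.trans h (localIncl_trivialization (mem_chart_source E q₀) hF s'))
  rw [Subtype.ext (eT.injective h1)]

/-- Applying the smooth inclusion to sections with constant coordinate `u` gives differentiability
for each fixed `u`. A finite basis of `F` upgrades this to differentiability as an operator-valued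
map. -/
theorem mdifferentiableAt_localIncl [ContMDiffVectorBundle ∞ F (fun q : Q ↦ D q) 𝓘(ℝ, E)]
    [FiniteDimensional ℝ F]
    (hincl : ContMDiff (constrModel E F) 𝓘(ℝ, E).tangent ∞ (distIncl (F := F) (D := D)))
    (q₀ : Q) :
    MDifferentiableAt 𝓘(ℝ, E) 𝓘(ℝ, F →L[ℝ] E) (localIncl F (D := D) q₀) q₀ := by
  have hF := FiberBundle.mem_baseSet_trivializationAt' (F := F) (E := fun q : Q ↦ D q) q₀
  have hpt : ∀ u : F, MDifferentiableAt 𝓘(ℝ, E) 𝓘(ℝ, E)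
      (fun q ↦ localIncl F (D := D) q₀ q u) q₀ := by
    intro u
    have h1 : ContMDiffAt 𝓘(ℝ, E) (constrModel E F) ∞ (fun q : Q ↦
        (⟨q, (trivializationAt F (fun q : Q ↦ D q) q₀).symmL ℝ q u⟩ :
          ConstraintManifold F D)) q₀ := by
      refine (contMDiffAt_section (F := F) (E := fun q : Q ↦ D q) q₀).2 ?_
      refine (contMDiffAt_const (c := u)).congr_of_eventuallyEq ?_
      filter_upwards [(trivializationAt F (fun q : Q ↦ D q) q₀).open_baseSet.mem_nhds hF] with q hq
      rw [← Trivialization.continuousLinearMapAt_apply_of_mem ℝ _ hq,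
        Trivialization.continuousLinearMapAt_symmL _ hq]
    have h2 := (contMDiffAt_totalSpace.1 (hincl.contMDiffAt.comp q₀ h1)).2
    refine (h2.mdifferentiableAt (by simp)).congr_of_eventuallyEq ?_
    filter_upwards [(chartAt E q₀).open_source.mem_nhds (mem_chart_source E q₀)] with q hq
    exact localIncl_apply hq u
  let b := Module.finBasis ℝ F
  let c : ∀ i, F →L[ℝ] ℝ := fun i ↦ LinearMap.toContinuousLinearMap (b.coord i)
  have hsum : localIncl F (D := D) q₀ = ∑ i, fun q ↦
      ContinuousLinearMap.smulRightL ℝ F E (c i) (localIncl F (D := D) q₀ q (b i)) := by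
    funext q
    ext u
    conv_lhs => rw [← b.sum_repr u, map_sum]
    simp [c]
  rw [hsum]
  exact MDifferentiableAt.sum fun i _ ↦
    (ContinuousLinearMap.smulRightL ℝ F E (c i)).mdifferentiableAt.comp q₀ (hpt (b i))

/-- A map is differentiable if its image under a differentiable family of injective linear maps
is. -/
theorem mdifferentiableAt_of_clm_apply {V : Type*} [NormedAddCommGroup V] [NormedSpace ℝ V]
    {N : Type*} [TopologicalSpace N] [ChartedSpace V N]
    {W F : Type*} [NormedAddCommGroup W] [NormedSpace ℝ W] [FiniteDimensional ℝ W]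
    [NormedAddCommGroup F] [NormedSpace ℝ F] [FiniteDimensional ℝ F]
    {A : N → F →L[ℝ] W} {u : N → F} {w : N → W} {x : N}
    (hA : MDifferentiableAt 𝓘(ℝ, V) 𝓘(ℝ, F →L[ℝ] W) A x) (hinj : Function.Injective (A x))
    (hw : MDifferentiableAt 𝓘(ℝ, V) 𝓘(ℝ, W) w x) (h : ∀ᶠ y in 𝓝 x, A y (u y) = w y) :
    MDifferentiableAt 𝓘(ℝ, V) 𝓘(ℝ, F) u x := by
  have : CompleteSpace F := FiniteDimensional.complete ℝ F
  -- A left inverse `L` of `A x` suffices: `L ∘ A y` is the identity at `x`, hence invertible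
  -- nearby, and there `u = (L ∘ A)⁻¹ (L w)`.
  obtain ⟨L₀, hL₀⟩ := (A x).toLinearMap.exists_leftInverse_of_injective
    (LinearMap.ker_eq_bot.2 hinj)
  let L : W →L[ℝ] F := LinearMap.toContinuousLinearMap L₀
  have hLA : L.comp (A x) = 1 := by
    ext v
    exact LinearMap.congr_fun hL₀ v
  let B : N → F →L[ℝ] F := fun y ↦ L.comp (A y)
  have hB : MDifferentiableAt 𝓘(ℝ, V) 𝓘(ℝ, F →L[ℝ] F) B x :=
    (ContinuousLinearMap.compL ℝ F W F L).mdifferentiableAt.comp x hA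
  have hunit : IsUnit (B x) := by
    simp only [B, hLA]
    exact isUnit_one
  have hinv : MDifferentiableAt 𝓘(ℝ, V) 𝓘(ℝ, F →L[ℝ] F) (fun y ↦ Ring.inverse (B y)) x :=
    (differentiableAt_inverse hunit).mdifferentiableAt.comp x hB
  have hLw : MDifferentiableAt 𝓘(ℝ, V) 𝓘(ℝ, F) (fun y ↦ L (w y)) x :=
    L.mdifferentiableAt.comp x hw
  refine (hinv.clm_apply hLw).congr_of_eventuallyEq ?_
  filter_upwards [h, hB.continuousAt.eventually (Units.isOpen.mem_nhds hunit)] with y hy hy'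
  have h1 : B y (u y) = L (w y) := congrArg L hy
  rw [← h1]
  exact (congrArg (fun T : F →L[ℝ] F ↦ T (u y)) (Ring.inverse_mul_cancel _ hy')).symm

variable [IsManifold 𝓘(ℝ, EG) ∞ G] [ContMDiffSMul 𝓘(ℝ, EG) 𝓘(ℝ, E) ∞ G Q]
  [ContMDiffVectorBundle ∞ F (fun q : Q ↦ D q) 𝓘(ℝ, E)]

/-- The fibre coordinate of `g • m` is the solution `u(g)` of `A(g • q) u(g) = Tg v`, where `A` is
the inclusion `D → TQ` in trivializations and the right side, read in the chart, is differentiable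
in `g`. Without this, `genM` could be the default derivative `0`. -/
theorem mdifferentiableAt_constrAct [FiniteDimensional ℝ E] (hD : DistInvariant G D)
    (hincl : ContMDiff (constrModel E F) 𝓘(ℝ, E).tangent ∞ (distIncl (F := F) (D := D)))
    (m : ConstraintManifold F D) :
    MDifferentiableAt 𝓘(ℝ, EG) (constrModel E F) (fun g : G ↦ constrAct hD g m) 1 := by
  have hfin : FiniteDimensional ℝ F := finiteDimensional_modelFibre (D := D) m.proj F
  have hF := FiberBundle.mem_baseSet_trivializationAt' (F := F) (E := fun q : Q ↦ D q) m.proj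
  have hev := tendsto_smul_nhds_one E EG (G := G) m.proj
  refine (Trivialization.mdifferentiableAt_totalSpace_iff 𝓘(ℝ, E)
    (trivializationAt F (fun q : Q ↦ D q) m.proj) _ ?_).2
    ⟨mdifferentiable_smul_right E EG m.proj 1, ?_⟩
  · rw [Trivialization.mem_source]
    change (1 : G) • m.proj ∈ _
    rw [one_smul]
    exact hF
  · have hA : MDifferentiableAt 𝓘(ℝ, EG) 𝓘(ℝ, F →L[ℝ] E)
        (fun g : G ↦ localIncl F (D := D) m.proj (g • m.proj)) 1 := by
      refine MDifferentiableAt.comp (I' := 𝓘(ℝ, E)) 1 (g := localIncl F (D := D) m.proj) ?_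
        (mdifferentiable_smul_right E EG m.proj 1)
      rw [one_smul]
      exact mdifferentiableAt_localIncl hincl m.proj
    have hw : MDifferentiableAt 𝓘(ℝ, EG) 𝓘(ℝ, E) (fun g : G ↦
        fderiv ℝ (localAction E EG G m.proj)
          (extChartAt 𝓘(ℝ, EG) (1 : G) g, extChartAt 𝓘(ℝ, E) m.proj m.proj)
          (0, (m.snd.1 : E))) 1 := by
      have h1 := ((hasFDerivAt_fderiv_apply (contDiffAt_two_localAction (EG := EG) (G := G) m.proj)
        ((0, (m.snd.1 : E)) : EG × E)).comp (extChartAt 𝓘(ℝ, EG) (1 : G) 1)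
        (hasFDerivAt_prodMk_left (𝕜 := ℝ) (extChartAt 𝓘(ℝ, EG) (1 : G) 1)
          (extChartAt 𝓘(ℝ, E) m.proj m.proj))).differentiableAt.mdifferentiableAt
      exact h1.comp (1 : G) (mdifferentiableAt_extChartAt (mem_chart_source EG (1 : G)))
    refine mdifferentiableAt_of_clm_apply hA ?_ hw ?_
    · rw [one_smul]
      exact localIncl_injective m.proj
    · filter_upwards [eventually_tangentAct_eq (E := E) (EG := EG) (G := G) m.proj,
        hev.eventually ((chartAt E m.proj).open_source.mem_nhds (mem_chart_source E m.proj)),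
        hev.eventually ((trivializationAt F (fun q : Q ↦ D q) m.proj).open_baseSet.mem_nhds hF)]
        with g hg1 hg2 hg3
      exact (localIncl_trivialization hg2 hg3 _).trans (hg1 _)

end ConstraintAction

/-! ### The generator on `M` and the momentum equation -/

section MomentumEquation

variable {E : Type*} [NormedAddCommGroup E] [NormedSpace ℝ E]
  {Q : Type*} [TopologicalSpace Q] [ChartedSpace E Q] [IsManifold 𝓘(ℝ, E) ∞ Q]
  {κ : RiemMetric E Q} {U : Q → ℝ}
  {F : Type*} [NormedAddCommGroup F] [NormedSpace ℝ F]
  {D : ∀ q : Q, Submodule ℝ (TangentSpace 𝓘(ℝ, E) q)}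
  [TopologicalSpace (ConstraintManifold F D)] [FiberBundle F (fun q : Q ↦ D q)]
  [VectorBundle ℝ F (fun q : Q ↦ D q)]
  [ContMDiffVectorBundle ∞ F (fun q : Q ↦ D q) 𝓘(ℝ, E)]
  {EG : Type*} [NormedAddCommGroup EG] [NormedSpace ℝ EG]
  {G : Type*} [TopologicalSpace G] [ChartedSpace EG G] [Group G] [MulAction G Q]
  [IsManifold 𝓘(ℝ, EG) ∞ G] [ContMDiffSMul 𝓘(ℝ, EG) 𝓘(ℝ, E) ∞ G Q]

theorem hasMFDerivAt_constrAct [FiniteDimensional ℝ E] (hD : DistInvariant G D)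
    (hincl : ContMDiff (constrModel E F) 𝓘(ℝ, E).tangent ∞ (distIncl (F := F) (D := D)))
    (m : ConstraintManifold F D) :
    HasMFDerivAt 𝓘(ℝ, EG) (constrModel E F) (fun g : G ↦ constrAct hD g m) 1
      (show EG →L[ℝ] E × F from genM hD m) :=
  (mdifferentiableAt_constrAct hD hincl m).hasMFDerivAt

theorem genM_fst [FiniteDimensional ℝ E] (hD : DistInvariant G D)
    (hincl : ContMDiff (constrModel E F) 𝓘(ℝ, E).tangent ∞ (distIncl (F := F) (D := D)))
    (m : ConstraintManifold F D) (η : GroupLieAlgebra 𝓘(ℝ, EG) G) :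
    (show E × F from genM hD m η).1 = genQ m.proj η := by
  have h := (hasMFDerivAt_bundleProj (constrAct hD (1 : G) m)).comp (1 : G)
    (hasMFDerivAt_constrAct (EG := EG) hD hincl m)
  exact congrArg (fun T : EG →L[ℝ] E ↦ T η) h.mfderiv.symm

theorem pairing_deriv_eq_zero {V E W : Type*} [NormedAddCommGroup V] [NormedSpace ℝ V]
    [NormedAddCommGroup E] [NormedSpace ℝ E] [NormedAddCommGroup W] [NormedSpace ℝ W]
    (j : W →L[ℝ] E →L[ℝ] ℝ) {P : V → E × W} {P' : V →L[ℝ] E × W} {w : V → E} {w' : V →L[ℝ] E}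
    {x : V} {c : ℝ} (hP : HasFDerivAt P P' x) (hw : HasFDerivAt w w' x)
    (h : ∀ᶠ y in 𝓝 x, j (P y).2 (w y) = c) (v : V) :
    j (P' v).2 (w x) + j (P x).2 (w' v) = 0 := by
  have h1 : HasFDerivAt (fun y ↦ j (P y).2) (j.comp ((ContinuousLinearMap.snd ℝ E W).comp P')) x :=
    j.hasFDerivAt.comp x hP.snd
  have h2 := (h1.clm_apply hw).unique ((hasFDerivAt_const c x).congr_of_eventuallyEq h)
  have h3 := congrArg (fun T : V →L[ℝ] ℝ ↦ T v) h2
  simpa [add_comm] using h3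

/-- The slice of the local action at the identity of `G` is the identity near the base point. -/
theorem fderiv_localAction_one (q : Q) (a : E) :
    fderiv ℝ (localAction E EG G q) (localOrigin E EG G q) (0, a) = a := by
  have h1 := (eventually_differentiableAt_localAction (E := E) (EG := EG) (G := G)
    q).self_of_nhds.hasFDerivAt.comp (extChartAt 𝓘(ℝ, E) q q)
    (hasFDerivAt_prodMk_right (𝕜 := ℝ) (extChartAt 𝓘(ℝ, EG) (1 : G) 1) (extChartAt 𝓘(ℝ, E) q q))
  have h2 := h1.unique ((hasFDerivAt_id (extChartAt 𝓘(ℝ, E) q q)).congr_of_eventuallyEq (by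
    filter_upwards [extChartAt_target_mem_nhds (I := 𝓘(ℝ, E)) q] with x hx
    simp only [localAction, Function.comp_apply, extChartAt_to_inv, one_smul, id]
    exact (extChartAt 𝓘(ℝ, E) q).right_inv hx))
  exact congrArg (fun T : E →L[ℝ] E ↦ T a) h2

/-- The fibre component of the infinitesimal generator on `M`, obtained by differentiating the
invariance of the metric. -/
theorem inclDeriv_genM_snd [FiniteDimensional ℝ E] (hL : LagrangianInvariant G (mechLagrangian κ U))
    (hD : DistInvariant G D)
    (hincl : ContMDiff (constrModel E F) 𝓘(ℝ, E).tangent ∞ (distIncl (F := F) (D := D)))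
    (m : ConstraintManifold F D) (η : GroupLieAlgebra 𝓘(ℝ, EG) G) (a : E) :
    (show E × (E →L[ℝ] ℝ) from inclDeriv κ m (genM hD m η)).2 a =
      -(κ.inner m.proj m.snd (secondDeriv E EG G m.proj ((η : EG), 0) (0, a))) := by
  let α := constrIncl κ m
  let χ := extChartAt 𝓘(ℝ, EG) (1 : G)
  -- `P` is the orbit of `ι(m)` in charts and `w` is the vector `a` moved by the tangent lift. Their
  -- pairing is `κ(gv, ga)`, constant by invariance, so its derivative at the identity vanishes.
  let P : EG → E × (E →L[ℝ] ℝ) := fun y ↦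
    extChartAt (cotModel E) α (constrIncl κ (constrAct hD (χ.symm y) m))
  let w : EG → E := fun y ↦ fderiv ℝ (localAction E EG G m.proj)
    (y, extChartAt 𝓘(ℝ, E) m.proj m.proj) (0, a)
  have hs : χ.symm (χ 1) = 1 := extChartAt_to_inv (1 : G)
  have hm : constrAct hD (χ.symm (χ 1)) m = m := by rw [hs, constrAct_one]
  have h1 : ∀ g : G, g = 1 → HasMFDerivAt 𝓘(ℝ, EG) (constrModel E F)
      (fun g : G ↦ constrAct hD g m) g (show EG →L[ℝ] E × F from genM hD m) := by
    rintro g rfl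
    exact hasMFDerivAt_constrAct hD hincl m
  have h2 : ∀ x : ConstraintManifold F D, x = m →
      HasMFDerivAt (constrModel E F) (cotModel E) (constrIncl κ) x
        (show E × F →L[ℝ] E × (E →L[ℝ] ℝ) from inclDeriv κ m) := by
    rintro x rfl
    exact hasMFDerivAt_constrIncl hincl _
  have h3 : ∀ x : ConstraintManifold F D, x = m →
      HasMFDerivAt (cotModel E) 𝓘(ℝ, E × (E →L[ℝ] ℝ)) (extChartAt (cotModel E) α) (constrIncl κ x)
        (ContinuousLinearMap.id ℝ (E × (E →L[ℝ] ℝ))) := by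
    rintro x rfl
    exact hasMFDerivAt_extChartAt_self _
  have hPm := (h3 _ hm).comp (χ 1) ((h2 _ hm).comp (χ 1) ((h1 _ hs).comp (χ 1)
    (hasMFDerivAt_extChartAt_symm_self (1 : G))))
  have hw := (hasFDerivAt_fderiv_apply
    (contDiffAt_two_localAction (E := E) (EG := EG) (G := G) m.proj) ((0, a) : EG × E)).comp (χ 1)
    (hasFDerivAt_prodMk_left (𝕜 := ℝ) (χ 1) (extChartAt 𝓘(ℝ, E) m.proj m.proj))
  have hconst : ∀ᶠ g : G in 𝓝 1, (extChartAt (cotModel E) α (constrIncl κ (constrAct hD g m))).2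
      (w (χ g)) = κ.inner m.proj m.snd a := by
    filter_upwards [eventually_tangentAct_eq (E := E) (EG := EG) (G := G) m.proj,
      (tendsto_smul_nhds_one E EG (G := G) m.proj).eventually
        ((chartAt E m.proj).open_source.mem_nhds (mem_chart_source E m.proj))] with g hg1 hg2
    rw [← metric_invariant hL g m.proj m.snd a]
    refine Eq.trans ?_ (snd_extChartAt_cotangent_apply α (constrIncl κ (constrAct hD g m)) hg2
      (tangentAct g m.proj a))
    exact congrArg _ (hg1 a).symm
  have hconst' : ∀ᶠ y in 𝓝 (χ 1), (P y).2 (w y) = κ.inner m.proj m.snd a := by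
    have hc : Filter.Tendsto χ.symm (𝓝 (χ 1)) (𝓝 1) := by
      have h := continuousAt_extChartAt_symm (I := 𝓘(ℝ, EG)) (1 : G)
      rw [ContinuousAt, extChartAt_to_inv] at h
      exact h
    filter_upwards [hc.eventually hconst, extChartAt_target_mem_nhds (I := 𝓘(ℝ, EG)) (1 : G)]
      with y hy hy'
    rw [χ.right_inv hy'] at hy
    exact hy
  have hmain := pairing_deriv_eq_zero (ContinuousLinearMap.id ℝ (E →L[ℝ] ℝ)) (P := P)
    (w := w) hPm.hasFDerivAt hw hconst' η
  have hw0 : w (χ 1) = a := fderiv_localAction_one m.proj a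
  have hP0 : (P (χ 1)).2 = κ.inner m.proj m.snd := by
    refine Eq.trans (congrArg (fun x ↦ (extChartAt (cotModel E) α (constrIncl κ x)).2) hm) ?_
    exact snd_extChartAt_cotangent_self α
  rw [hw0, hP0] at hmain
  exact eq_neg_of_add_eq_zero_left hmain

/-- The generator `η_M` is the Hamiltonian vector field of the momentum. -/
theorem omegaM_genM [FiniteDimensional ℝ E]
    (hL : LagrangianInvariant G (mechLagrangian κ U)) (hD : DistInvariant G D)
    (hincl : ContMDiff (constrModel E F) 𝓘(ℝ, E).tangent ∞ (distIncl (F := F) (D := D)))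
    (m : ConstraintManifold F D) (η : GroupLieAlgebra 𝓘(ℝ, EG) G)
    (w : TangentSpace (constrModel E F) m) :
    OmegaM κ m (genM hD m η) w = mfderiv (cotModel E) 𝓘(ℝ, ℝ)
      (linearFunction (fun q : Q ↦ genQ q η)) (constrIncl κ m) (inclDeriv κ m w) := by
  obtain ⟨T, hT, hTu⟩ := exists_hasMFDerivAt_linearFunction_genQ η (constrIncl κ m)
  rw [hT.mfderiv]
  refine (omegaM_apply hincl m (genM hD m η) w).trans (Eq.trans ?_ (hTu (inclDeriv κ m w)).symm)
  have h1 := genM_fst hD hincl m η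
  have h2 := inclDeriv_genM_snd (κ := κ) hL hD hincl m η
  have h3 := inclDeriv_fst (κ := κ) hincl m w
  have h4 := secondDeriv_symm (E := E) (EG := EG) (G := G) m.proj
  -- The covector part of `Tι w` is evaluated at `η_Q` on both sides; what remains is an equality of
  -- mixed second derivatives.
  have h5 : ∀ (p : E →L[ℝ] ℝ) (x : E) (r s : ℝ), x = genQ m.proj η → r = -s →
      p x - r = p (genQ m.proj η) + s := by
    rintro p x r s rfl rfl
    ring
  refine h5 _ _ _ _ h1 ((h2 _).trans (congrArg Neg.neg ?_))
  refine congrArg (κ.inner m.proj m.snd) ((h4 _ _).trans ?_)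
  exact congrArg (fun x : E ↦ secondDeriv E EG G m.proj (0, x) ((η : EG), 0)) h3.symm

end MomentumEquation

/-! ### Pairings and differentials of finite sums -/

theorem sub_mem_sympOrthogonal_iff {V : Type*} [AddCommGroup V] [Module ℝ V] [TopologicalSpace V]
    {σ : V →L[ℝ] V →L[ℝ] ℝ} {C : Submodule ℝ V} {a b : V} :
    a - b ∈ sympOrthogonal σ C ↔ ∀ w ∈ C, σ b w = σ a w := by
  refine forall₂_congr fun w _ ↦ ?_
  rw [map_sub, sub_apply, sub_eq_zero, eq_comm]

/-- This is the shape of the right side of (i), each `-hamVector` being a value of `π_nh^♯`; the two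
minus signs cancel in the functional it represents. -/
theorem sub_sum_smul_neg_hamVector {V : Type*} [AddCommGroup V] [Module ℝ V] [TopologicalSpace V]
    {σ : V →L[ℝ] V →L[ℝ] ℝ} {C : Submodule ℝ V} [FiniteDimensional ℝ C]
    (hσ : ∀ v ∈ C, (∀ w ∈ C, σ v w = 0) → v = 0) {ι : Type*} (t : Finset ι) (c : ι → ℝ)
    (β : ι → V →L[ℝ] ℝ) {x : V} (hx : x ∈ C) :
    x - ∑ i ∈ t, c i • -hamVector σ C (β i) ∈ C ∧
      ∀ w ∈ C, σ (x - ∑ i ∈ t, c i • -hamVector σ C (β i)) w = σ x w + ∑ i ∈ t, c i * β i w := by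
  refine ⟨C.sub_mem hx (C.sum_mem fun i _ ↦
    C.smul_mem _ (C.neg_mem (hamVector_spec hσ (β i)).1)), fun w hw ↦ ?_⟩
  simp only [map_sub, map_sum, map_smul, map_neg, sub_apply, sum_apply, smul_apply, neg_apply,
    (hamVector_spec hσ (β _)).2 w hw, smul_eq_mul, mul_neg, Finset.sum_neg_distrib, sub_neg_eq_add]

theorem apply_sum_smul {V W : Type*} [AddCommGroup V] [Module ℝ V] [TopologicalSpace V]
    [AddCommGroup W] [Module ℝ W] [TopologicalSpace W]
    (σ : V →L[ℝ] V →L[ℝ] ℝ) (L : W →L[ℝ] V) {ι : Type*} (t : Finset ι) (c : ι → ℝ) (η : ι → W)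
    (w : V) : σ (L (∑ i ∈ t, c i • η i)) w = ∑ i ∈ t, c i * σ (L (η i)) w := by
  simp only [map_sum, map_smul, sum_apply, smul_apply, smul_eq_mul]

theorem exists_hasMFDerivAt_sum_mul {V : Type*} [NormedAddCommGroup V] [NormedSpace ℝ V]
    {H : Type*} [TopologicalSpace H] {J : ModelWithCorners ℝ V H}
    {N : Type*} [TopologicalSpace N] [ChartedSpace H N] {ι : Type} {t : Finset ι}
    {p r : ι → N → ℝ} {x : N} {p' r' : ι → V →L[ℝ] ℝ}
    (hp : ∀ i, HasMFDerivAt J 𝓘(ℝ, ℝ) (p i) x (p' i))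
    (hr : ∀ i, HasMFDerivAt J 𝓘(ℝ, ℝ) (r i) x (r' i)) :
    ∃ T : V →L[ℝ] ℝ, HasMFDerivAt J 𝓘(ℝ, ℝ) (fun y ↦ ∑ i ∈ t, p i y * r i y) x T ∧
      ∀ u, T u = ∑ i ∈ t, (p i x * r' i u + r i x * p' i u) := by
  let T : ι → V →L[ℝ] ℝ := fun i ↦ p i x • r' i + r i x • p' i
  have hT : ∀ i ∈ t, HasMFDerivAt J 𝓘(ℝ, ℝ) (p i * r i) x (T i) := fun i _ ↦ (hp i).mul (hr i)
  have hsum := HasMFDerivAt.sum (f := fun i ↦ p i * r i) hT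
  exact ⟨∑ i ∈ t, T i, hsum.congr_of_eventuallyEq (.of_forall fun y ↦ by simp),
    fun u ↦ by simp [T]⟩

/-! ### Cotangent lifts and their projection to `C` -/

section Lift

variable {E : Type*} [NormedAddCommGroup E] [NormedSpace ℝ E]
  {Q : Type*} [TopologicalSpace Q] [ChartedSpace E Q] [IsManifold 𝓘(ℝ, E) ∞ Q]

/-- Test against `(x, 0)` and `(0, r)`; continuous functionals separate the points of `E`. -/
theorem omega_nondegenerate (α : CotangentBundle E Q) (v : TangentSpace (cotModel E) α)
    (h : ∀ w, Omega α v w = 0) : v = 0 := by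
  obtain ⟨a, p⟩ : E × (E →L[ℝ] ℝ) := v
  have h1 : ∀ w : E × (E →L[ℝ] ℝ), w.2 a - p w.1 = 0 := fun w ↦
    (omega_apply α (a, p) w).symm.trans (h w)
  have hp : p = 0 := by
    ext x
    simpa using h1 (x, 0)
  have ha : a = 0 := by
    refine (SeparatingDual.eq_zero_iff_forall_dual_eq_zero (R := ℝ) a).2 fun r ↦ ?_
    simpa using h1 (0, r)
  subst hp ha
  rfl

theorem omega_cotangentLift [FiniteDimensional ℝ E] (X : ∀ q : Q, TangentSpace 𝓘(ℝ, E) q)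
    (α : CotangentBundle E Q) (w : TangentSpace (cotModel E) α) :
    Omega α (cotangentLift X α) w = mfderiv (cotModel E) 𝓘(ℝ, ℝ) (linearFunction X) α w := by
  have : FiniteDimensional ℝ (TangentSpace (cotModel E) α) :=
    inferInstanceAs (FiniteDimensional ℝ (E × (E →L[ℝ] ℝ)))
  have h : cotangentLift X α = hamVector (Omega α) ⊤
      (mfderiv (cotModel E) 𝓘(ℝ, ℝ) (linearFunction X) α) := neg_neg _
  rw [h]
  exact (hamVector_spec (C := ⊤) (fun v _ h ↦ omega_nondegenerate α v fun w ↦ h w trivial) _).2 w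
    trivial

variable {κ : RiemMetric E Q}
  {F : Type*} [NormedAddCommGroup F] [NormedSpace ℝ F]
  {D : ∀ q : Q, Submodule ℝ (TangentSpace 𝓘(ℝ, E) q)}
  [TopologicalSpace (ConstraintManifold F D)] [FiberBundle F (fun q : Q ↦ D q)]

variable [VectorBundle ℝ F (fun q : Q ↦ D q)]

theorem finiteDimensional_tangentSpace {Q : Type*} [TopologicalSpace Q] [ChartedSpace E Q]
    {D : ∀ q : Q, Submodule ℝ (TangentSpace 𝓘(ℝ, E) q)}
    [TopologicalSpace (ConstraintManifold F D)] [FiberBundle F (fun q : Q ↦ D q)]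
    [VectorBundle ℝ F (fun q : Q ↦ D q)] [FiniteDimensional ℝ E] (m : ConstraintManifold F D) :
    FiniteDimensional ℝ (TangentSpace (constrModel E F) m) := by
  have : FiniteDimensional ℝ F := finiteDimensional_modelFibre (D := D) m.proj F
  exact inferInstanceAs (FiniteDimensional ℝ (E × F))

/-- `Ω_M` is the pullback of `Ω_Q`, so its nondegeneracy on `C` is that of `Ω_Q` on the image of
`C`. -/
theorem isCompl_distCImage [FiniteDimensional ℝ E]
    (hincl : ContMDiff (constrModel E F) 𝓘(ℝ, E).tangent ∞ (distIncl (F := F) (D := D)))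
    (m : ConstraintManifold F D) :
    IsCompl (distCImage κ m) (sympOrthogonal (Omega (constrIncl κ m)) (distCImage κ m)) := by
  have : FiniteDimensional ℝ (TangentSpace (cotModel E) (constrIncl κ m)) :=
    inferInstanceAs (FiniteDimensional ℝ (E × (E →L[ℝ] ℝ)))
  refine isCompl_sympOrthogonal ?_
  rintro _ ⟨v, hv, rfl⟩ h
  rw [omegaM_nondegenerate hincl m v hv fun w hw ↦ h _ ⟨w, hw, rfl⟩, map_zero]

/-- `Y - Tι v ∈ C^Ω` says that `Ω_M(v, ·)` and `Ω_Q(Y, Tι ·)` agree on `C`. Nondegeneracy makes such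
a `v` unique, so the default value of `projC` is not taken. -/
theorem projC_eq
    (hincl : ContMDiff (constrModel E F) 𝓘(ℝ, E).tangent ∞ (distIncl (F := F) (D := D)))
    (m : ConstraintManifold F D) {Y : TangentSpace (cotModel E) (constrIncl κ m)}
    {v : TangentSpace (constrModel E F) m} (hv : v ∈ distC m)
    (h : ∀ w ∈ distC m, OmegaM κ m v w = Omega (constrIncl κ m) Y (inclDeriv κ m w)) :
    projC κ m Y = v := by
  have hiff : ∀ u : TangentSpace (constrModel E F) m,
      Y - inclDeriv κ m u ∈ sympOrthogonal (Omega (constrIncl κ m)) (distCImage κ m) ↔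
      ∀ w ∈ distC m, OmegaM κ m u w = Omega (constrIncl κ m) Y (inclDeriv κ m w) := by
    intro u
    rw [sub_mem_sympOrthogonal_iff]
    exact ⟨fun hu w hw ↦ hu _ ⟨w, hw, rfl⟩, fun hu _ ⟨w, hw, hw'⟩ ↦ hw' ▸ hu w hw⟩
  have hex : ∃! v : TangentSpace (constrModel E F) m, v ∈ distC m ∧
      Y - inclDeriv κ m v ∈ sympOrthogonal (Omega (constrIncl κ m)) (distCImage κ m) := by
    refine ⟨v, ⟨hv, (hiff v).2 h⟩, fun u hu ↦ ?_⟩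
    refine sub_eq_zero.1 (omegaM_nondegenerate (κ := κ) hincl m _
      ((distC m).sub_mem hu.1 hv) fun w hw ↦ ?_)
    rw [map_sub, sub_apply, (hiff u).1 hu.2 w hw, h w hw, sub_self]
  rw [projC, dif_pos hex]
  exact hex.unique hex.choose_spec.1 ⟨hv, (hiff v).2 h⟩

variable {EG : Type*} [NormedAddCommGroup EG] [NormedSpace ℝ EG]
  {G : Type*} [TopologicalSpace G] [ChartedSpace EG G] [Group G] [MulAction G Q]

/-- The criterion by which both (i) and (ii) are verified: it combines `projC_eq` with the defining
equation of the cotangent lift. -/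
theorem mCotangentLift_eq [FiniteDimensional ℝ E]
    (hincl : ContMDiff (constrModel E F) 𝓘(ℝ, E).tangent ∞ (distIncl (F := F) (D := D)))
    (ξ : Q → GroupLieAlgebra 𝓘(ℝ, EG) G) (m : ConstraintManifold F D)
    {v : TangentSpace (constrModel E F) m} (hv : v ∈ distC m)
    (h : ∀ w ∈ distC m, OmegaM κ m v w = mfderiv (cotModel E) 𝓘(ℝ, ℝ)
      (linearFunction (sectionGenQ ξ)) (constrIncl κ m) (inclDeriv κ m w)) :
    mCotangentLift κ ξ m = v :=
  projC_eq hincl m hv fun w hw ↦ by rw [h w hw, omega_cotangentLift]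

variable [IsManifold 𝓘(ℝ, EG) ∞ G] [ContMDiffSMul 𝓘(ℝ, EG) 𝓘(ℝ, E) ∞ G Q]

/-- `Θ_Q` evaluates a covector on the projected vector, and `ξ_M` projects to `ξ_Q`. -/
theorem nhMomentum_eq [FiniteDimensional ℝ E]
    [ContMDiffVectorBundle ∞ F (fun q : Q ↦ D q) 𝓘(ℝ, E)]
    (hincl : ContMDiff (constrModel E F) 𝓘(ℝ, E).tangent ∞ (distIncl (F := F) (D := D)))
    (hD : DistInvariant G D) (ξ : Q → GroupLieAlgebra 𝓘(ℝ, EG) G) (m : ConstraintManifold F D) :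
    nhMomentum κ hD ξ m = linearFunction (sectionGenQ ξ) (constrIncl κ m) := by
  refine congrArg (κ.inner m.proj m.snd) ?_
  rw [mfderiv_cotProj]
  exact (inclDeriv_fst hincl m (genM hD m (ξ m.proj))).trans (genM_fst hD hincl m (ξ m.proj))

/-- The differential of `α ↦ α(ξ_Q)` for `ξ = ∑ f_i η_i`. -/
theorem exists_hasMFDerivAt_linearFunction_section {n : ℕ} {f : Fin n → Q → ℝ}
    (hf : ∀ i, ContMDiff 𝓘(ℝ, E) 𝓘(ℝ, ℝ) ∞ (f i))
    {η : Fin n → GroupLieAlgebra 𝓘(ℝ, EG) G} {ξ : Q → GroupLieAlgebra 𝓘(ℝ, EG) G}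
    (hξf : ∀ q, ξ q = ∑ i, f i q • η i) (α : CotangentBundle E Q) :
    ∃ T : TangentSpace (cotModel E) α →L[ℝ] ℝ,
      HasMFDerivAt (cotModel E) 𝓘(ℝ, ℝ) (linearFunction (sectionGenQ ξ)) α T ∧
      ∀ u : E × (E →L[ℝ] ℝ), T u = ∑ i, (f i α.proj * (show ℝ from mfderiv (cotModel E) 𝓘(ℝ, ℝ)
        (linearFunction (fun q : Q ↦ genQ q (η i))) α u) +
        momentum α (η i) * (show ℝ from mfderiv 𝓘(ℝ, E) 𝓘(ℝ, ℝ) (f i) α.proj u.1)) := by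
  have hp : ∀ i, HasMFDerivAt (cotModel E) 𝓘(ℝ, ℝ) (fun β : CotangentBundle E Q ↦ f i β.proj) α
      ((show E →L[ℝ] ℝ from mfderiv 𝓘(ℝ, E) 𝓘(ℝ, ℝ) (f i) α.proj).comp
        (ContinuousLinearMap.fst ℝ E (E →L[ℝ] ℝ))) := fun i ↦
    ((hf i).mdifferentiable (by simp) α.proj).hasMFDerivAt.comp α (hasMFDerivAt_bundleProj α)
  have hr : ∀ i, HasMFDerivAt (cotModel E) 𝓘(ℝ, ℝ) (linearFunction (fun q : Q ↦ genQ q (η i))) α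
      (mfderiv (cotModel E) 𝓘(ℝ, ℝ) (linearFunction (fun q : Q ↦ genQ q (η i))) α) := fun i ↦ by
    obtain ⟨T, hT, -⟩ := exists_hasMFDerivAt_linearFunction_genQ (η i) α
    exact hT.mdifferentiableAt.hasMFDerivAt
  obtain ⟨T, hT, hTu⟩ := exists_hasMFDerivAt_sum_mul (t := Finset.univ) hp hr
  refine ⟨T, hT.congr_of_eventuallyEq (.of_forall fun β ↦ ?_), hTu⟩
  simp only [linearFunction, sectionGenQ, hξf, map_sum, map_smul, smul_eq_mul]

end Lift

end Nonholonomic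

end

/-! ### The theorem -/

open Nonholonomic in
theorem lemma3p2
    {E : Type*} [NormedAddCommGroup E] [NormedSpace ℝ E] [FiniteDimensional ℝ E]
    {Q : Type*} [TopologicalSpace Q] [ChartedSpace E Q] [IsManifold 𝓘(ℝ, E) ∞ Q]
    -- the kinetic energy metric and the potential
    (κ : RiemMetric E Q) (U : Q → ℝ) (hU : ContMDiff 𝓘(ℝ, E) 𝓘(ℝ, ℝ) ∞ U)
    -- the regular distribution, a smooth vector subbundle of the tangent bundle
    {F : Type*} [NormedAddCommGroup F] [NormedSpace ℝ F]
    (D : ∀ q : Q, Submodule ℝ (TangentSpace 𝓘(ℝ, E) q))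
    [TopologicalSpace (ConstraintManifold F D)] [FiberBundle F (fun q : Q ↦ D q)]
    [VectorBundle ℝ F (fun q : Q ↦ D q)]
    [ContMDiffVectorBundle ∞ F (fun q : Q ↦ D q) 𝓘(ℝ, E)]
    (hincl : ContMDiff (constrModel E F) 𝓘(ℝ, E).tangent ∞ (distIncl (F := F) (D := D)))
    -- the symmetry group, acting freely and properly
    {EG : Type*} [NormedAddCommGroup EG] [NormedSpace ℝ EG] [FiniteDimensional ℝ EG]
    {G : Type*} [TopologicalSpace G] [ChartedSpace EG G] [Group G] [LieGroup 𝓘(ℝ, EG) ∞ G]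
    [MulAction G Q] [ContMDiffSMul 𝓘(ℝ, EG) 𝓘(ℝ, E) ∞ G Q] [ProperSMul G Q]
    (hfree : ∀ (g : G) (q : Q), g • q = q → g = 1)
    (hL : LagrangianInvariant G (mechLagrangian κ U)) (hD : DistInvariant G D)
    -- the section `ξ = ∑ f_i η_i` of `𝔤_S`
    {n : ℕ} (f : Fin n → Q → ℝ) (hf : ∀ i, ContMDiff 𝓘(ℝ, E) 𝓘(ℝ, ℝ) ∞ (f i))
    (η : Fin n → GroupLieAlgebra 𝓘(ℝ, EG) G)
    (ξ : Q → GroupLieAlgebra 𝓘(ℝ, EG) G) (hξ : ∀ q, ξ q ∈ gS D q)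
    (hξf : ∀ q, ξ q = ∑ i, f i q • η i) :
    -- the objects below are well defined
    (∀ (α : CotangentBundle E Q) (v : TangentSpace (cotModel E) α),
      (∀ w, Omega α v w = 0) → v = 0) ∧
    (∀ m : ConstraintManifold F D,
      IsCompl (distCImage κ m) (sympOrthogonal (Omega (constrIncl κ m)) (distCImage κ m))) ∧
    (∀ (m : ConstraintManifold F D), ∀ v ∈ distC m,
      (∀ w ∈ distC m, OmegaM κ m v w = 0) → v = 0) ∧
    -- (i)
    (∀ m : ConstraintManifold F D,
      mCotangentLift κ ξ m = sectionGenM hD ξ m -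
        ∑ i, momentum (constrIncl κ m) (η i) •
          nhSharp κ m (mfderiv (constrModel E F) 𝓘(ℝ, ℝ) (fun x ↦ f i (constrProj x)) m)) ∧
    -- (ii)
    (∀ m : ConstraintManifold F D,
      mCotangentLift κ ξ m =
        -nhSharp κ m (mfderiv (constrModel E F) 𝓘(ℝ, ℝ) (nhMomentum κ hD ξ) m)) := by
  have hman : IsManifold 𝓘(ℝ, EG) ∞ G := inferInstance
  have hnondeg := omegaM_nondegenerate (F := F) (D := D) (κ := κ) hincl
  have hfin : ∀ m : ConstraintManifold F D, FiniteDimensional ℝ (TangentSpace (constrModel E F) m) :=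
    finiteDimensional_tangentSpace
  refine ⟨omega_nondegenerate, isCompl_distCImage hincl, hnondeg, fun m ↦ ?_, fun m ↦ ?_⟩
  · obtain ⟨T, hT, hTu⟩ := exists_hasMFDerivAt_linearFunction_section hf hξf (constrIncl κ m)
    -- `ξ_M` projects to `ξ_Q`, which lies in `D` because `ξ` is a section of `𝔤_S`.
    have hmem : sectionGenM hD ξ m ∈ distC m := by
      refine mem_distC.2 ?_
      have h := genM_fst hD hincl m (ξ m.proj)
      exact h ▸ (hξ m.proj).1
    have hspec := sub_sum_smul_neg_hamVector (hnondeg m) Finset.univ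
      (fun i ↦ momentum (constrIncl κ m) (η i)) (fun i ↦ mfderiv (constrModel E F) 𝓘(ℝ, ℝ)
        (fun x : ConstraintManifold F D ↦ f i (constrProj x)) m) hmem
    refine mCotangentLift_eq hincl ξ m hspec.1 fun w hw ↦ (hspec.2 w hw).trans ?_
    rw [hT.mfderiv]
    refine Eq.trans ?_ (hTu (inclDeriv κ m w)).symm
    -- The two halves of the Leibniz rule: `∑ f_i d⟨J, η_i⟩` matches `Ω_M(ξ_M, ·)`, and `∑ ⟨J, η_i⟩
    -- df_i` matches the `π_nh^♯` terms.
    rw [Finset.sum_add_distrib]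
    refine congrArg₂ (· + ·) ?_ (Finset.sum_congr rfl fun i _ ↦ congrArg _ ?_)
    · rw [sectionGenM, hξf]
      refine (apply_sum_smul (OmegaM κ m) (genM hD m) _ _ _ w).trans ?_
      exact Finset.sum_congr rfl fun i _ ↦ congrArg _ (omegaM_genM hL hD hincl m (η i) w)
    · have h := ((hf i).mdifferentiable (by simp) (constrProj m)).hasMFDerivAt.comp m
        (hasMFDerivAt_constrProj m)
      have h' := inclDeriv_fst (κ := κ) hincl m w
      refine Eq.trans (congrArg (fun T : E × F →L[ℝ] ℝ ↦ T w) h.mfderiv) ?_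
      exact congrArg (show E →L[ℝ] ℝ from mfderiv 𝓘(ℝ, E) 𝓘(ℝ, ℝ) (f i) m.proj) h'.symm
  · obtain ⟨T, hT, -⟩ := exists_hasMFDerivAt_linearFunction_section hf hξf (constrIncl κ m)
    -- By the chain rule the functional that determines `ξ_Q^M` is then `d⟨J^nh, ξ⟩` itself.
    have hmom : nhMomentum κ hD ξ = linearFunction (sectionGenQ ξ) ∘ constrIncl κ :=
      funext (nhMomentum_eq hincl hD ξ)
    have hd := hT.comp m (hasMFDerivAt_constrIncl hincl m)
    rw [← hmom] at hd
    have hsharp : ∀ β : TangentSpace (constrModel E F) m →L[ℝ] ℝ,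
      -nhSharp κ m β = hamVector (OmegaM κ m) (distC m) β := fun β ↦ neg_neg _
    refine Eq.trans ?_ (hsharp _).symm
    have hspec := hamVector_spec (hnondeg m)
      (mfderiv (constrModel E F) 𝓘(ℝ, ℝ) (nhMomentum κ hD ξ) m)
    refine mCotangentLift_eq hincl ξ m hspec.1 fun w hw ↦ (hspec.2 w hw).trans ?_
    rw [hd.mfderiv, hT.mfderiv]
    rfl
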